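/- Let $\lambda=(\lambda_n)$ be a frequency, that is, a strictly increasing sequence of non-negative real numbers with $\lambda_n\to\infty$, and let $\ell\ge 0$ be real. A Dirichlet series $\sum a_n e^{-\lambda_n s}$ with complex coefficients $a_n$ is called a $\lambda$-Riesz germ of a holomorphic function $f:\{s\in\mathbb{C}:\operatorname{Re} s>0\}\to\mathbb{C}$ if there are $m\ge 0$ and $\sigma\in\mathbb{R}$ such that $$f(s)=\lim_{x\to\infty}\sum_{\lambda_n<x}a_n e^{-\lambda_n s}\Big(1-\frac{\lambda_n}{x}\Big)^m\qquad\text{for all } s\in\mathbb{C}\text{ with }\operatorname{Re} s>0\text{ and }\operatorname{Re} s>\sigma .$$ Let $H_{\infty,\ell}^{\lambda}[\operatorname{Re}>0]$ be the set of all holomorphic functions $f:\{\operatorname{Re} s>0\}\to\mathbb{C}$ that have a $\lambda$-Riesz germ and satisfy $$\|f\|_{\infty,\ell}=\sup_{\operatorname{Re} s>0}\frac{|f(s)|}{(1+|s|)^{\ell}}<\infty .$$ Then $H_{\infty,\ell}^{\lambda}[\operatorname{Re}>0]$ is a linear space (under the pointwise operations), $\|\cdot\|_{\infty,\ell}$ is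 a norm on it, and with this norm it is a (complex) Banach space. -/

import Mathlib

namespace RieszDirichlet

open Filter Topology

noncomputable section

/-- A frequency: a strictly increasing, non-negative real sequence tending to infinity
(so that each of the sums over `lam n < x` below is finite). -/
structure IsFrequency (lam : ℕ → ℝ) : Prop where
  strictMono : StrictMono lam
  nonneg : ∀ n, 0 ≤ lam n
  tendsto_atTop : Tendsto lam atTop atTop

/-- The open right half-plane `[Re > 0]`. -/
abbrev RightHalfPlane : Type := {s : ℂ // 0 < s.re}

/-- Holomorphy of a function on the open right half-plane. (The values outside the half-plane of
the extension by zero play no role, since the half-plane is open.) -/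
def IsHolomorphic (f : RightHalfPlane → ℂ) : Prop :=
  DifferentiableOn ℂ (Function.extend Subtype.val f 0) {s : ℂ | 0 < s.re}

/-- The Riesz mean of first kind and order `m`, at `s`, of the Dirichlet series
`∑ a n * exp (- lam n * s)`: the sum over all `n` with `lam n < x` of
`a n * exp (- lam n * s) * (1 - lam n / x) ^ m`. -/
def rieszMean (lam : ℕ → ℝ) (m : ℝ) (a : ℕ → ℂ) (x : ℝ) (s : ℂ) : ℂ :=
  ∑ᶠ n ∈ {n : ℕ | lam n < x},
    a n * Complex.exp (-(lam n : ℂ) * s) * (((1 - lam n / x) ^ m : ℝ) : ℂ)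

/-- The Dirichlet series with coefficients `a` is a Riesz germ of `f`: for some order `m ≥ 0` its
Riesz means converge to `f` at all points of some half-plane `[Re > σ]` that belong to the domain
`[Re > 0]` of `f`. -/
def IsRieszGerm (lam : ℕ → ℝ) (a : ℕ → ℂ) (f : RightHalfPlane → ℂ) : Prop :=
  ∃ m : ℝ, 0 ≤ m ∧ ∃ σ : ℝ, ∀ s : RightHalfPlane, σ < (s : ℂ).re →
    Tendsto (fun x : ℝ => rieszMean lam m a x s) atTop (𝓝 (f s))

/-- The weighted quotient `|f(s)| / (1 + |s|) ^ ℓ`. -/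
def weightedAbs (ℓ : ℝ) (f : RightHalfPlane → ℂ) (s : RightHalfPlane) : ℝ :=
  ‖f s‖ / (1 + ‖(s : ℂ)‖) ^ ℓ

/-- The norm `sup_{Re s > 0} |f(s)| / (1 + |s|) ^ ℓ`. -/
def supNorm (ℓ : ℝ) (f : RightHalfPlane → ℂ) : ℝ := ⨆ s, weightedAbs ℓ f s

/-- The set of all holomorphic functions on `[Re > 0]` that are generated by a Riesz germ and for
which the supremum of `|f(s)| / (1 + |s|) ^ ℓ` is finite. -/
def HInfty (lam : ℕ → ℝ) (ℓ : ℝ) : Set (RightHalfPlane → ℂ) :=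
  {f | IsHolomorphic f ∧ (∃ a : ℕ → ℂ, IsRieszGerm lam a f) ∧
    BddAbove (Set.range (weightedAbs ℓ f))}

/-- The complex vector space `E` together with `N : E → ℝ` is a Banach space: `N` satisfies the
axioms of a norm, and `E` is complete for the metric `N (x - y)`. -/
def IsBanachSpace (E : Type*) [AddCommGroup E] [Module ℂ E] (N : E → ℝ) : Prop :=
  letI : Norm E := ⟨N⟩
  ∃ h : NormedSpace.Core ℂ E,
    letI : NormedAddCommGroup E := NormedAddCommGroup.ofCore h
    CompleteSpace E

end

end RieszDirichlet

namespace RieszDirichlet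

open Filter Topology MeasureTheory

noncomputable section

/-! Closedness under limits is the only hard point, and Perron's formula settles it. Fix a natural
number `k ≥ ℓ + 1`, `k ≠ 0`. If `F` has growth `(1 + |s|) ^ ℓ` and a Riesz germ `a`, then `∑ a n *
(x - lam n)₊ ^ k = k! / (2πi) * ∫_{Re s = 1} F s * s ^ (-k - 1) * exp (s * x) ds`
(`rieszSum_eq_perron`). Neither `k` nor the line depends on the order or the abscissa of the germ.
The right side is at most `C_k * ‖F‖ * exp x` (`HasGrowth.norm_perron_one_le`), so the Riesz sums,
and hence the coefficients, depend continuously on `F`.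

A Cauchy sequence therefore has a pointwise limit `f` that is holomorphic with the same growth, and
its Riesz sums converge. Solving a triangular system (`exists_tendsto_coeff`), the coefficients
converge too, and Perron's formula passes to the limit. Conversely, Perron's formula makes the
limiting series a Riesz germ of `f` of order `k` on `Re > 1`
(`tendsto_rieszMean_of_rieszSum_eq_perron`).

For Perron's formula itself, consistency (`tendsto_rieszMean_of_le`) raises the order of the germ to
some natural `k + j`. A convolution formula for multiplication by exponentials bounds the Riesz sums
exponentially and expresses `F` as `s ^ (k + j + 1) / (k + j)!` times their Laplace transform.
Fourier inversion gives the formula on a line far to the right, Cauchy's theorem moves it to `Re =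
1`, and differentiating in `x` descends from order `k + j` to `k`. -/

/-- The unnormalised Riesz sum `∑ a n * (x - lam n)₊ ^ k`. -/
def rieszSum (lam : ℕ → ℝ) (k : ℕ) (a : ℕ → ℂ) (x : ℝ) : ℂ :=
  ∑ᶠ n, a n * ((max (x - lam n) 0 ^ k : ℝ) : ℂ)

/-! ### Riesz sums and means as finite sums -/

theorem IsFrequency.exists_forall_le {lam : ℕ → ℝ} (hlam : IsFrequency lam) (T : ℝ) :
    ∃ N, ∀ n, N ≤ n → T ≤ lam n :=
  eventually_atTop.1 (hlam.tendsto_atTop.eventually_ge_atTop T)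

/-- One `N` serves all `x ≤ T`, so the finite sum can be taken out of integrals and derivatives in
`x`. The order must be nonzero: with `0 ^ 0 = 1` the terms beyond `x` would not vanish. -/
theorem rieszSum_eq_sum {lam : ℕ → ℝ} {T : ℝ} {N : ℕ} (hN : ∀ n, N ≤ n → T ≤ lam n) {k : ℕ}
    (hk : k ≠ 0) (a : ℕ → ℂ) {x : ℝ} (hx : x ≤ T) :
    rieszSum lam k a x = ∑ n ∈ Finset.range N, a n * ((max (x - lam n) 0 ^ k : ℝ) : ℂ) := by
  refine finsum_eq_sum_of_support_subset _ fun n hn => ?_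
  by_contra h
  simp only [Finset.coe_range, Set.mem_Iio, not_lt] at h
  have := hN n h
  rw [Function.mem_support] at hn
  exact hn (by rw [max_eq_right (by linarith), zero_pow hk]; simp)

theorem rieszMean_eq_sum {lam : ℕ → ℝ} {T : ℝ} {N : ℕ} (hN : ∀ n, N ≤ n → T ≤ lam n) (m : ℝ)
    (a : ℕ → ℂ) {x : ℝ} (hx : x ≤ T) (s : ℂ) :
    rieszMean lam m a x s = ∑ n ∈ Finset.range N, a n * Complex.exp (-(lam n : ℂ) * s) *
      ((if lam n < x then (1 - lam n / x) ^ m else 0 : ℝ) : ℂ) := by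
  have : rieszMean lam m a x s = ∑ᶠ n, a n * Complex.exp (-(lam n : ℂ) * s) *
      ((if lam n < x then (1 - lam n / x) ^ m else 0 : ℝ) : ℂ) := by
    refine finsum_congr fun n => ?_
    by_cases h : lam n < x <;> simp [h]
  rw [this]
  refine finsum_eq_sum_of_support_subset _ fun n hn => ?_
  by_contra h
  simp only [Finset.coe_range, Set.mem_Iio, not_lt] at h
  have := hN n h
  rw [Function.mem_support] at hn
  exact hn (by rw [if_neg (by linarith)]; simp)

theorem pow_mul_rieszMean {lam : ℕ → ℝ} (hlam : IsFrequency lam) {k : ℕ} (hk : k ≠ 0)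
    (a : ℕ → ℂ) {x : ℝ} (hx : 0 < x) (s : ℂ) :
    (x : ℂ) ^ k * rieszMean lam k a x s =
      rieszSum lam k (fun n => a n * Complex.exp (-(lam n : ℂ) * s)) x := by
  obtain ⟨N, hN⟩ := hlam.exists_forall_le x
  rw [rieszMean_eq_sum hN _ _ le_rfl, rieszSum_eq_sum hN hk _ le_rfl, Finset.mul_sum]
  refine Finset.sum_congr rfl fun n _ => ?_
  rw [mul_left_comm]
  congr 1
  rw [← Complex.ofReal_pow, ← Complex.ofReal_mul]
  congr 1
  split_ifs with h
  · rw [max_eq_left (by linarith), Real.rpow_natCast, ← mul_pow]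
    congr 1
    field_simp
  · rw [max_eq_right (by linarith), zero_pow hk, mul_zero]

/-! ### Consistency of Riesz summation -/

/-- The damping factors of the Riesz means lie in `[0, 1]`. -/
theorem rieszWeight_mem_Icc {l x m : ℝ} (hl : 0 ≤ l) (hm : 0 ≤ m) :
    (if l < x then (1 - l / x) ^ m else 0 : ℝ) ∈ Set.Icc (0 : ℝ) 1 := by
  split_ifs with h
  · have hx : 0 < x := hl.trans_lt h
    have h1 : l / x ≤ 1 := (div_le_one hx).2 h.le
    have h2 : 0 ≤ l / x := by positivity
    exact ⟨Real.rpow_nonneg (by linarith) _, Real.rpow_le_one (by linarith) (by linarith) hm⟩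
  · simp

/-- Convergence bounds the means beyond some `X`; below `X` only finitely many terms occur, with
damping factors in `[0, 1]`. -/
theorem exists_norm_rieszMean_le {lam : ℕ → ℝ} (hlam : IsFrequency lam) {m : ℝ} (hm : 0 ≤ m)
    {a : ℕ → ℂ} {s L : ℂ} (h : Tendsto (fun x : ℝ => rieszMean lam m a x s) atTop (𝓝 L)) :
    ∃ C, ∀ x : ℝ, ‖rieszMean lam m a x s‖ ≤ C := by
  obtain ⟨X, hX⟩ := eventually_atTop.1 ((h.norm).eventually_le_const (lt_add_one ‖L‖))
  obtain ⟨N, hN⟩ := hlam.exists_forall_le X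
  refine ⟨max (‖L‖ + 1) (∑ n ∈ Finset.range N, ‖a n * Complex.exp (-(lam n : ℂ) * s)‖),
    fun x => ?_⟩
  rcases le_total X x with hx | hx
  · exact (hX x hx).trans (le_max_left _ _)
  · refine le_trans ?_ (le_max_right _ _)
    rw [rieszMean_eq_sum hN _ _ hx]
    refine (norm_sum_le _ _).trans (Finset.sum_le_sum fun n _ => ?_)
    rw [norm_mul _ (Complex.ofReal _), Complex.norm_real, Real.norm_eq_abs]
    have := rieszWeight_mem_Icc (x := x) (hlam.nonneg n) hm
    rw [abs_of_nonneg this.1]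
    exact mul_le_of_le_one_right (norm_nonneg _) this.2

/-- Averaging the damping factors of order `m` against a beta density yields those of a larger
order. -/
theorem integral_rieszWeight {m q l x : ℝ} (hl : 0 ≤ l) (hx : 0 < x) :
    ∫ u in (0 : ℝ)..1, (1 - u) ^ q * u ^ m *
        (if l < u * x then (1 - l / (u * x)) ^ m else 0) =
      (∫ u in (0 : ℝ)..1, (1 - u) ^ q * u ^ m) *
        (if l < x then (1 - l / x) ^ (q + m + 1) else 0) := by
  set y := l / x with hy
  have hy0 : 0 ≤ y := by positivity
  have h1 : ∫ u in (0 : ℝ)..1, (1 - u) ^ q * u ^ m *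
        (if l < u * x then (1 - l / (u * x)) ^ m else 0) =
      ∫ u in Set.Ioc (0 : ℝ) 1, (Set.Ioi y).indicator (fun u => (1 - u) ^ q * (u - y) ^ m) u := by
    rw [intervalIntegral.integral_of_le zero_le_one]
    refine setIntegral_congr_fun measurableSet_Ioc fun u hu => ?_
    have hu0 := hu.1
    have e : l < u * x ↔ y < u := by rw [hy, div_lt_iff₀ hx]
    simp only [Set.indicator_apply, Set.mem_Ioi]
    by_cases h : y < u
    · rw [if_pos (e.2 h), if_pos h, mul_assoc, ← Real.mul_rpow hu0.le]
      · congr 2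
        rw [hy]; field_simp
      · rw [sub_nonneg, div_le_one (by positivity)]
        exact (e.2 h).le
    · rw [if_neg (e.not.2 h), if_neg h, mul_zero]
  rw [h1, setIntegral_indicator measurableSet_Ioi]
  have e : l < x ↔ y < 1 := by rw [hy, div_lt_one hx]
  by_cases h : y < 1
  · rw [if_pos (e.2 h)]
    have : Set.Ioc (0 : ℝ) 1 ∩ Set.Ioi y = Set.Ioc y 1 := by
      ext u
      simp only [Set.mem_inter_iff, Set.mem_Ioc, Set.mem_Ioi]
      constructor
      · rintro ⟨⟨_, h⟩, h'⟩; exact ⟨h', h⟩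
      · rintro ⟨h', h⟩; exact ⟨⟨by linarith, h⟩, h'⟩
    rw [this, ← intervalIntegral.integral_of_le h.le]
    have hc : 0 < 1 - y := by linarith
    -- The substitution `u = (1 - y) * v + y` extracts `(1 - y) ^ (q + m + 1)` and leaves the full
    -- beta integral.
    have h2 := intervalIntegral.smul_integral_comp_mul_add (a := 0) (b := 1)
      (fun u : ℝ => (1 - u) ^ q * (u - y) ^ m) (1 - y) y
    simp only [mul_zero, zero_add, mul_one, sub_add_cancel, smul_eq_mul] at h2
    rw [← h2, ← intervalIntegral.integral_const_mul, ← intervalIntegral.integral_mul_const]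
    refine intervalIntegral.integral_congr fun v hv => ?_
    rw [Set.uIcc_of_le zero_le_one] at hv
    have e1 : 1 - ((1 - y) * v + y) = (1 - y) * (1 - v) := by ring
    have e2 : (1 - y) * v + y - y = (1 - y) * v := by ring
    simp only [e1, e2]
    rw [Real.mul_rpow hc.le (by linarith [hv.2]), Real.mul_rpow hc.le hv.1,
      Real.rpow_add hc, Real.rpow_add hc, Real.rpow_one]
    ring
  · rw [if_neg (e.not.2 h)]
    have : Set.Ioc (0 : ℝ) 1 ∩ Set.Ioi y = ∅ := by
      ext u
      simp only [Set.mem_inter_iff, Set.mem_Ioc, Set.mem_Ioi, Set.mem_empty_iff_false, iff_false]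
      rintro ⟨⟨_, h⟩, h'⟩; linarith
    rw [this]; simp

theorem measurable_rieszWeight {m l x : ℝ} :
    Measurable fun u : ℝ => if l < u * x then (1 - l / (u * x)) ^ m else 0 := by
  refine Measurable.ite (measurableSet_lt (by fun_prop) (by fun_prop)) (by fun_prop) (by fun_prop)

theorem norm_betaDensity_le {m q u : ℝ} (hm : 0 ≤ m) (hq : 0 ≤ q) (hu : u ∈ Set.Ioc (0 : ℝ) 1) :
    |(1 - u) ^ q * u ^ m| ≤ 1 := by
  have h1 : (1 - u) ^ q ≤ 1 := Real.rpow_le_one (by linarith [hu.2]) (by linarith [hu.1]) hq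
  have h2 : u ^ m ≤ 1 := Real.rpow_le_one hu.1.le hu.2 hm
  have h3 : 0 ≤ (1 - u) ^ q := Real.rpow_nonneg (by linarith [hu.2]) _
  have h4 : 0 ≤ u ^ m := Real.rpow_nonneg hu.1.le _
  rw [abs_of_nonneg (by positivity)]
  exact mul_le_one₀ h1 h4 h2

theorem intervalIntegrable_rieszWeight {m q l x : ℝ} (hm : 0 ≤ m) (hq : 0 ≤ q) (hl : 0 ≤ l) :
    IntervalIntegrable (fun u : ℝ => (1 - u) ^ q * u ^ m *
        (if l < u * x then (1 - l / (u * x)) ^ m else 0)) volume 0 1 := by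
  rw [intervalIntegrable_iff_integrableOn_Ioc_of_le zero_le_one]
  refine Measure.integrableOn_of_bounded (M := 1) (by simp) ?_ ?_
  · exact (Measurable.mul (by fun_prop) measurable_rieszWeight).aestronglyMeasurable
  · refine (ae_restrict_iff' measurableSet_Ioc).2 (ae_of_all _ fun u hu => ?_)
    have h := rieszWeight_mem_Icc (x := u * x) hl hm
    rw [norm_mul, Real.norm_eq_abs, Real.norm_eq_abs, abs_of_nonneg h.1]
    exact mul_le_one₀ (norm_betaDensity_le hm hq hu) h.1 h.2

theorem rieszMean_eq_integral {lam : ℕ → ℝ} (hlam : IsFrequency lam) {m q : ℝ} (hm : 0 ≤ m)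
    (hq : 0 ≤ q) (a : ℕ → ℂ) {x : ℝ} (hx : 0 < x) (s : ℂ) :
    ∫ u in (0 : ℝ)..1, (((1 - u) ^ q * u ^ m : ℝ) : ℂ) * rieszMean lam m a (u * x) s =
      ((∫ u in (0 : ℝ)..1, (1 - u) ^ q * u ^ m : ℝ) : ℂ) *
        rieszMean lam (q + m + 1) a x s := by
  obtain ⟨N, hN⟩ := hlam.exists_forall_le x
  rw [rieszMean_eq_sum hN _ _ le_rfl, Finset.mul_sum]
  have h1 : ∫ u in (0 : ℝ)..1, (((1 - u) ^ q * u ^ m : ℝ) : ℂ) * rieszMean lam m a (u * x) s =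
      ∫ u in (0 : ℝ)..1, ∑ n ∈ Finset.range N, a n * Complex.exp (-(lam n : ℂ) * s) *
        (((1 - u) ^ q * u ^ m *
        (if lam n < u * x then (1 - lam n / (u * x)) ^ m else 0) : ℝ) : ℂ) := by
    refine intervalIntegral.integral_congr fun u hu => ?_
    rw [Set.uIcc_of_le zero_le_one] at hu
    rw [rieszMean_eq_sum hN _ _ (mul_le_of_le_one_left hx.le hu.2), Finset.mul_sum]
    refine Finset.sum_congr rfl fun n _ => ?_
    rw [Complex.ofReal_mul (_ * _)]
    ring
  rw [h1, intervalIntegral.integral_finsetSum]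
  · refine Finset.sum_congr rfl fun n _ => ?_
    rw [intervalIntegral.integral_const_mul, intervalIntegral.integral_ofReal,
      integral_rieszWeight (hlam.nonneg n) hx, Complex.ofReal_mul]
    ring
  · intro n _
    have h := intervalIntegrable_rieszWeight (x := x) hm hq (hlam.nonneg n)
    exact IntervalIntegrable.const_mul ⟨h.1.ofReal, h.2.ofReal⟩ _

theorem betaDensity_integral_pos {m q : ℝ} (hm : 0 ≤ m) (hq : 0 ≤ q) :
    0 < ∫ u in (0 : ℝ)..1, (1 - u) ^ q * u ^ m := by
  refine intervalIntegral.intervalIntegral_pos_of_pos_on ?_ (fun u hu => ?_) zero_lt_one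
  · refine Continuous.intervalIntegrable ?_ _ _
    exact ((continuous_const.sub continuous_id).rpow_const fun _ => Or.inr hq).mul
      (continuous_id.rpow_const fun _ => Or.inr hm)
  · exact mul_pos (Real.rpow_pos_of_pos (by linarith [hu.2]) _) (Real.rpow_pos_of_pos hu.1 _)

/-- Consistency of Riesz summation: convergence is inherited by higher orders. -/
theorem tendsto_rieszMean_of_le {lam : ℕ → ℝ} (hlam : IsFrequency lam) {m m' : ℝ} (hm : 0 ≤ m)
    (hm' : m + 1 ≤ m') {a : ℕ → ℂ} {s L : ℂ}
    (h : Tendsto (fun x : ℝ => rieszMean lam m a x s) atTop (𝓝 L)) :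
    Tendsto (fun x : ℝ => rieszMean lam m' a x s) atTop (𝓝 L) := by
  -- Raising the order by at least one makes `q ≥ 0`, so the beta density is bounded by `1` and has
  -- no singularity at `u = 1`.
  obtain ⟨q, hq, rfl⟩ : ∃ q, 0 ≤ q ∧ m' = q + m + 1 := ⟨m' - m - 1, by linarith, by ring⟩
  obtain ⟨C, hC⟩ := exists_norm_rieszMean_le hlam hm h
  have hC0 : 0 ≤ C := (norm_nonneg _).trans (hC 0)
  set B : ℝ := ∫ u in (0 : ℝ)..1, (1 - u) ^ q * u ^ m with hB
  have hB0 : (B : ℂ) ≠ 0 := Complex.ofReal_ne_zero.2 (betaDensity_integral_pos hm hq).ne'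
  have key : Tendsto (fun x : ℝ => ∫ u in (0 : ℝ)..1,
      (((1 - u) ^ q * u ^ m : ℝ) : ℂ) * rieszMean lam m a (u * x) s) atTop
      (𝓝 (∫ u in (0 : ℝ)..1, (((1 - u) ^ q * u ^ m : ℝ) : ℂ) * L)) := by
    refine intervalIntegral.tendsto_integral_filter_of_dominated_convergence (fun _ => C) ?_ ?_
      (by simp) ?_
    · filter_upwards [eventually_gt_atTop 0] with x hx
      obtain ⟨N, hN⟩ := hlam.exists_forall_le x
      refine Measurable.aestronglyMeasurable (f := fun u => (((1 - u) ^ q * u ^ m : ℝ) : ℂ) *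
        ∑ n ∈ Finset.range N, a n * Complex.exp (-(lam n : ℂ) * s) *
        ((if lam n < u * x then (1 - lam n / (u * x)) ^ m else 0 : ℝ) : ℂ)) ?_ |>.congr ?_
      · refine Measurable.mul (by fun_prop) (Finset.measurable_sum _ fun n _ => ?_)
        exact (Complex.measurable_ofReal.comp measurable_rieszWeight).const_mul _
      · rw [Filter.EventuallyEq, Set.uIoc_of_le zero_le_one, ae_restrict_iff' measurableSet_Ioc]
        refine ae_of_all _ fun u hu => ?_
        rw [rieszMean_eq_sum hN _ _ (mul_le_of_le_one_left hx.le hu.2)]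
    · refine Eventually.of_forall fun x => ae_of_all _ fun u hu => ?_
      rw [Set.uIoc_of_le zero_le_one] at hu
      rw [norm_mul, Complex.norm_real, Real.norm_eq_abs]
      calc _ ≤ 1 * C := mul_le_mul (norm_betaDensity_le hm hq hu) (hC _) (norm_nonneg _) zero_le_one
        _ = C := one_mul _
    · refine ae_of_all _ fun u hu => ?_
      rw [Set.uIoc_of_le zero_le_one] at hu
      exact (h.comp (tendsto_id.const_mul_atTop hu.1)).const_mul _
  rw [intervalIntegral.integral_mul_const, intervalIntegral.integral_ofReal, ← hB] at key
  have := key.const_mul (B : ℂ)⁻¹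
  rw [inv_mul_cancel_left₀ hB0] at this
  refine this.congr' ?_
  filter_upwards [eventually_gt_atTop 0] with x hx
  rw [rieszMean_eq_integral hlam hm hq a hx, ← hB, inv_mul_cancel_left₀ hB0]

/-! ### Convolution formula for multiplication by an exponential -/

open Polynomial in
/-- The operator on polynomials corresponding to the derivative of `exp (-w * u) * P u`. -/
def twistedDeriv (w : ℂ) (P : ℂ[X]) : ℂ[X] := derivative P - C w * P

open Polynomial in
theorem hasDerivAt_exp_mul_eval (w : ℂ) (P : ℂ[X]) (u : ℝ) :
    HasDerivAt (fun u : ℝ => Complex.exp (-w * u) * P.eval (u : ℂ))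
      (Complex.exp (-w * u) * (twistedDeriv w P).eval (u : ℂ)) u := by
  have h1 : HasDerivAt (fun z : ℂ => Complex.exp (-w * z) * P.eval z)
      (Complex.exp (-w * u) * (twistedDeriv w P).eval (u : ℂ)) (u : ℂ) := by
    have h2 : HasDerivAt (fun z : ℂ => -w * z) (-w) (u : ℂ) := by
      simpa using (hasDerivAt_id (u : ℂ)).const_mul (-w)
    refine (h2.cexp.mul (P.hasDerivAt (u : ℂ))).congr_deriv ?_
    simp only [twistedDeriv, eval_sub, eval_mul, eval_C]
    ring
  exact h1.comp_ofReal

open Polynomial in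
theorem continuous_exp_mul_eval (w : ℂ) (P : ℂ[X]) :
    Continuous fun u : ℝ => Complex.exp (-w * u) * P.eval (u : ℂ) :=
  continuous_iff_continuousAt.2 fun u => (hasDerivAt_exp_mul_eval w P u).continuousAt

open Polynomial in
/-- Taylor's formula with integral remainder for `exp (-w * y) * P y`, where all derivatives of
order less than `m` vanish at `0`. -/
theorem exp_mul_eval_eq (w : ℂ) (P : ℂ[X]) (y : ℝ) (m : ℕ)
    (h : ∀ i < m, ((twistedDeriv w)^[i] P).eval 0 = 0) :
    Complex.exp (-w * y) * P.eval (y : ℂ) =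
      ((twistedDeriv w)^[m] P).eval 0 * ((y : ℂ) ^ m / (m.factorial : ℂ)) +
      ∫ u in (0 : ℝ)..y, ((y : ℂ) - u) ^ m / (m.factorial : ℂ) *
        (Complex.exp (-w * u) * ((twistedDeriv w)^[m + 1] P).eval (u : ℂ)) := by
  induction m with
  | zero =>
    have := intervalIntegral.integral_eq_sub_of_hasDerivAt (a := 0) (b := y)
      (fun u _ => hasDerivAt_exp_mul_eval w P u)
      ((continuous_exp_mul_eval w (twistedDeriv w P)).intervalIntegrable _ _)
    rw [Function.iterate_zero, Function.iterate_one, id]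
    simp only [pow_zero, Nat.factorial_zero, Nat.cast_one, div_one, mul_one, one_mul]
    rw [this]
    simp
  | succ m ih =>
    rw [ih fun i hi => h i (by omega), h m (by omega), zero_mul, zero_add]
    set Q := (twistedDeriv w)^[m + 1] P with hQ
    have hQ' : (twistedDeriv w)^[m + 1 + 1] P = twistedDeriv w Q := by
      rw [Function.iterate_succ_apply' _ (m + 1)]
    rw [hQ']
    have hu (u : ℝ) : HasDerivAt (fun u : ℝ => -(((y : ℂ) - u) ^ (m + 1) /
        ((m + 1).factorial : ℂ))) (((y : ℂ) - u) ^ m / (m.factorial : ℂ)) u := by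
      have h1 : HasDerivAt (fun z : ℂ => -(((y : ℂ) - z) ^ (m + 1) /
        ((m + 1).factorial : ℂ))) (((y : ℂ) - u) ^ m / (m.factorial : ℂ)) (u : ℂ) := by
        have h2 := ((((hasDerivAt_id (u : ℂ)).const_sub (y : ℂ)).pow (m + 1)).div_const
          ((m + 1).factorial : ℂ)).neg
        refine h2.congr_deriv ?_
        have : ((m : ℂ) + 1) ≠ 0 := by exact_mod_cast m.succ_ne_zero
        rw [Nat.factorial_succ]
        push_cast
        simp only [id]
        have h0 : (m.factorial : ℂ) ≠ 0 := by exact_mod_cast m.factorial_ne_zero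
        field_simp
      exact h1.comp_ofReal
    have := intervalIntegral.integral_mul_deriv_eq_deriv_mul (a := 0) (b := y)
      (fun u _ => hasDerivAt_exp_mul_eval w Q u) (fun u _ => hu u)
      ((continuous_exp_mul_eval w (twistedDeriv w Q)).intervalIntegrable _ _)
      (Continuous.intervalIntegrable (by fun_prop) _ _)
    simp_rw [mul_comm (_ / _ : ℂ)]
    rw [this]
    simp only [mul_neg, intervalIntegral.integral_neg]
    simp

-- Each step lowers the order of vanishing at `0` by at most one and keeps the degree at most `m`.
-- The lowest coefficient comes from differentiation alone, the top one from multiplication by `-w`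
-- alone. The latter becomes the factor `s ^ (m + 1)` of the Laplace formula.
open Polynomial in
theorem factorial_mul_coeff_iterate_twistedDeriv (w : ℂ) (m i : ℕ) :
    (∀ j, i + j < m → ((twistedDeriv w)^[i] (X ^ m)).coeff j = 0) ∧
    (∀ j, i + j = m →
      (j.factorial : ℂ) * ((twistedDeriv w)^[i] (X ^ m)).coeff j = (m.factorial : ℂ)) ∧
    ((twistedDeriv w)^[i] (X ^ m)).natDegree ≤ m ∧
    ((twistedDeriv w)^[i] (X ^ m)).coeff m = (-w) ^ i := by
  induction i with
  | zero =>
    refine ⟨fun j hj => ?_, fun j hj => ?_, by simp, by simp⟩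
    · simp only [Function.iterate_zero, id, coeff_X_pow]
      rw [if_neg (by omega)]
    · simp only [Function.iterate_zero, id, coeff_X_pow]
      rw [if_pos (by omega), mul_one, ← hj, zero_add]
  | succ i ih =>
    obtain ⟨h1, h2, h3, h4⟩ := ih
    rw [Function.iterate_succ_apply']
    set Q := (twistedDeriv w)^[i] (X ^ m) with hQ
    have hc (j : ℕ) : (twistedDeriv w Q).coeff j = Q.coeff (j + 1) * (j + 1) - w * Q.coeff j := by
      simp [twistedDeriv, coeff_derivative]
    refine ⟨fun j hj => ?_, fun j hj => ?_, ?_, ?_⟩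
    · rw [hc, h1 _ (by omega), h1 _ (by omega)]; simp
    · rw [hc, h1 j (by omega), ← h2 (j + 1) (by omega), Nat.factorial_succ]
      push_cast; ring
    · refine (natDegree_sub_le _ _).trans (max_le ?_ ?_)
      · exact (natDegree_derivative_le _).trans (by omega)
      · exact (natDegree_C_mul_le _ _).trans h3
    · rw [hc, h4, coeff_eq_zero_of_natDegree_lt (by omega)]; ring

open Polynomial in
/-- A convolution formula for multiplication of `y ^ m` by an exponential. -/
theorem exists_polynomial_exp_mul_pow (w : ℂ) (m : ℕ) :
    ∃ p : ℂ[X], p.natDegree ≤ m ∧ p.coeff m = (-w) ^ (m + 1) / (m.factorial : ℂ) ∧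
      ∀ y : ℝ, Complex.exp (-w * y) * (y : ℂ) ^ m =
        (y : ℂ) ^ m + ∫ u in (0 : ℝ)..y, ((y : ℂ) - u) ^ m *
          (Complex.exp (-w * u) * p.eval (u : ℂ)) := by
  have hf : (m.factorial : ℂ) ≠ 0 := by exact_mod_cast m.factorial_ne_zero
  refine ⟨C (m.factorial : ℂ)⁻¹ * (twistedDeriv w)^[m + 1] (X ^ m), ?_, ?_, fun y => ?_⟩
  · exact (natDegree_C_mul_le _ _).trans
      (factorial_mul_coeff_iterate_twistedDeriv w m (m + 1)).2.2.1
  · rw [coeff_C_mul, (factorial_mul_coeff_iterate_twistedDeriv w m (m + 1)).2.2.2]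
    field_simp
  · have h := exp_mul_eval_eq w (X ^ m) y m fun i hi => by
      rw [← coeff_zero_eq_eval_zero]
      exact (factorial_mul_coeff_iterate_twistedDeriv w m i).1 0 (by omega)
    have h2 := (factorial_mul_coeff_iterate_twistedDeriv w m m).2.1 0 (by omega)
    rw [Nat.factorial_zero, Nat.cast_one, one_mul] at h2
    rw [← coeff_zero_eq_eval_zero, h2, mul_div_cancel₀ _ hf, eval_pow, eval_X] at h
    rw [h]
    congr 1
    refine intervalIntegral.integral_congr fun u _ => ?_
    simp only [eval_mul, eval_C]
    field_simp

/-! ### Riesz means, growth of Riesz sums and the Laplace transform -/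

theorem continuous_rieszSum {lam : ℕ → ℝ} (hlam : IsFrequency lam) {k : ℕ} (hk : k ≠ 0)
    (a : ℕ → ℂ) : Continuous (rieszSum lam k a) := by
  refine continuous_iff_continuousAt.2 fun x => ?_
  obtain ⟨N, hN⟩ := hlam.exists_forall_le (x + 1)
  refine ContinuousAt.congr (f := fun x : ℝ =>
    ∑ n ∈ Finset.range N, a n * ((max (x - lam n) 0 ^ k : ℝ) : ℂ)) ?_ ?_
  · exact Continuous.continuousAt (by fun_prop)
  · filter_upwards [eventually_lt_nhds (lt_add_one x)] with z hz
    exact (rieszSum_eq_sum hN hk a hz.le).symm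

theorem rieszSum_of_nonpos {lam : ℕ → ℝ} (hlam : IsFrequency lam) {k : ℕ} (hk : k ≠ 0)
    (a : ℕ → ℂ) {x : ℝ} (hx : x ≤ 0) : rieszSum lam k a x = 0 := by
  rw [rieszSum_eq_sum (N := 0) (fun n _ => hlam.nonneg n) hk a hx]; simp

open Polynomial in
/-- The Riesz sums of `∑ a n * exp (-lam n * s)` in terms of those of `∑ a n`. -/
theorem exists_polynomial_rieszSum_mul_exp {lam : ℕ → ℝ} (hlam : IsFrequency lam) {m : ℕ}
    (hm : m ≠ 0) (s : ℂ) :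
    ∃ p : ℂ[X], p.natDegree ≤ m ∧ p.coeff m = s ^ (m + 1) / (m.factorial : ℂ) ∧
      ∀ (a : ℕ → ℂ) (x : ℝ), 0 ≤ x →
        rieszSum lam m (fun n => a n * Complex.exp (-(lam n : ℂ) * s)) x =
          Complex.exp (-s * x) * rieszSum lam m a x +
          ∫ t in (0 : ℝ)..x, rieszSum lam m a t *
            (Complex.exp (-s * t) * p.eval ((x - t : ℝ) : ℂ)) := by
  obtain ⟨p, hp1, hp2, hp3⟩ := exists_polynomial_exp_mul_pow (-s) m
  rw [neg_neg] at hp2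
  refine ⟨p, hp1, hp2, fun a x hx => ?_⟩
  -- The convolution formula at `y = x - l` with `w = -s`, multiplied by `exp (-s * x)` and
  -- reflected by `u = x - t`. The integrand vanishes for `t ≤ l`, so the integral may start at `0`
  -- for every `l`.
  have term (l : ℝ) (hl : 0 ≤ l) :
      Complex.exp (-(l : ℂ) * s) * ((max (x - l) 0 ^ m : ℝ) : ℂ) =
        Complex.exp (-s * x) * ((max (x - l) 0 ^ m : ℝ) : ℂ) +
        ∫ t in (0 : ℝ)..x, ((max (t - l) 0 ^ m : ℝ) : ℂ) *
            (Complex.exp (-s * t) * p.eval ((x - t : ℝ) : ℂ)) := by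
    have zero {z : ℝ} (hz : 0 ≤ z) (hzl : z ≤ l) : ∫ t in (0 : ℝ)..z,
        ((max (t - l) 0 ^ m : ℝ) : ℂ) *
          (Complex.exp (-s * t) * p.eval ((x - t : ℝ) : ℂ)) = 0 := by
      refine (intervalIntegral.integral_congr (g := fun _ => (0 : ℂ)) fun t ht => ?_).trans
        intervalIntegral.integral_zero
      rw [Set.uIcc_of_le hz] at ht
      beta_reduce
      rw [max_eq_right (by linarith [ht.2]), zero_pow hm]; simp
    rcases le_total x l with h | h
    · rw [max_eq_right (by linarith), zero_pow hm, zero hx h]; simp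
    · have hcont : Continuous fun t : ℝ => ((max (t - l) 0 ^ m : ℝ) : ℂ) *
          (Complex.exp (-s * t) * p.eval ((x - t : ℝ) : ℂ)) := by
        have := p.continuous
        fun_prop
      rw [← intervalIntegral.integral_add_adjacent_intervals
        (hcont.intervalIntegrable 0 l) (hcont.intervalIntegrable l x), zero hl le_rfl, zero_add,
        max_eq_left (by linarith)]
      have h3 := hp3 (x - l)
      have e1 : ∫ t in l..x, ((max (t - l) 0 ^ m : ℝ) : ℂ) *
          (Complex.exp (-s * t) * p.eval ((x - t : ℝ) : ℂ)) =
          ∫ t in l..x, Complex.exp (-s * x) * ((fun u : ℝ => (((x - l : ℝ) : ℂ) - u) ^ m *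
          (Complex.exp (-(-s) * u) * p.eval (u : ℂ))) (x - t)) := by
        refine intervalIntegral.integral_congr fun t ht => ?_
        rw [Set.uIcc_of_le h] at ht
        simp only
        rw [max_eq_left (by linarith [ht.1])]
        have : Complex.exp (-s * t) = Complex.exp (-s * x) * Complex.exp (-(-s) * ((x - t : ℝ) : ℂ)) := by
          rw [← Complex.exp_add]; congr 1; push_cast; ring
        rw [this]
        push_cast; ring
      rw [e1, intervalIntegral.integral_const_mul, intervalIntegral.integral_comp_sub_left
          (fun u : ℝ => (((x - l : ℝ) : ℂ) - u) ^ m *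
          (Complex.exp (-(-s) * u) * p.eval (u : ℂ))), sub_self,
        ← mul_add, Complex.ofReal_pow, ← h3, ← mul_assoc, ← Complex.exp_add]
      congr 2
      push_cast; ring
  obtain ⟨N, hN⟩ := hlam.exists_forall_le x
  have e2 : ∫ t in (0 : ℝ)..x, rieszSum lam m a t *
            (Complex.exp (-s * t) * p.eval ((x - t : ℝ) : ℂ)) =
      ∫ t in (0 : ℝ)..x, ∑ n ∈ Finset.range N, a n * (((max (t - lam n) 0 ^ m : ℝ) : ℂ) *
            (Complex.exp (-s * t) * p.eval ((x - t : ℝ) : ℂ))) := by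
    refine intervalIntegral.integral_congr fun t ht => ?_
    rw [Set.uIcc_of_le hx] at ht
    rw [rieszSum_eq_sum hN hm _ ht.2, Finset.sum_mul]
    exact Finset.sum_congr rfl fun n _ => mul_assoc _ _ _
  rw [e2, intervalIntegral.integral_finsetSum, rieszSum_eq_sum hN hm _ le_rfl,
    rieszSum_eq_sum hN hm _ le_rfl, Finset.mul_sum, ← Finset.sum_add_distrib]
  · refine Finset.sum_congr rfl fun n _ => ?_
    rw [intervalIntegral.integral_const_mul, mul_assoc, term _ (hlam.nonneg n)]
    ring
  · intro n _
    refine Continuous.intervalIntegrable ?_ _ _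
    have := p.continuous
    fun_prop

theorem integrable_rieszSum_mul_exp {lam : ℕ → ℝ} (hlam : IsFrequency lam) {m : ℕ} (hm : m ≠ 0)
    {a : ℕ → ℂ} {C c : ℝ} (hA : ∀ t, ‖rieszSum lam m a t‖ ≤ C * Real.exp (c * t)) {s : ℂ}
    (hs : c < s.re) : Integrable fun t : ℝ => rieszSum lam m a t * Complex.exp (-s * t) := by
  have h : IntegrableOn (fun t : ℝ => rieszSum lam m a t * Complex.exp (-s * t)) (Set.Ioi 0) := by
    have h1 := (integrableOn_exp_mul_Ioi (a := c - s.re) (by linarith) 0).const_mul C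
    refine Integrable.mono' h1 ?_ (ae_of_all _ fun t => ?_)
    · have := continuous_rieszSum hlam hm a
      exact (Continuous.aestronglyMeasurable (by fun_prop)).restrict
    · rw [norm_mul, Complex.norm_exp]
      calc _ ≤ C * Real.exp (c * t) * Real.exp (-s * t : ℂ).re := by gcongr; exact hA t
        _ = _ := by
          rw [mul_assoc, ← Real.exp_add]
          congr 2
          simp; ring
  refine (integrableOn_iff_integrable_of_support_subset fun t ht => ?_).1 h
  by_contra h0
  exact ht (by simp only [rieszSum_of_nonpos hlam hm a (not_lt.1 h0), zero_mul])

open Polynomial in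
theorem norm_eval_le_of_natDegree_le {p : ℂ[X]} {m : ℕ} (hp : p.natDegree ≤ m) {z : ℂ} {y : ℝ}
    (hy : 1 ≤ y) (hz : ‖z‖ ≤ y) :
    ‖p.eval z‖ ≤ (∑ i ∈ Finset.range (m + 1), ‖p.coeff i‖) * y ^ m := by
  rw [eval_eq_sum_range' (Nat.lt_succ_of_le hp), Finset.sum_mul]
  refine (norm_sum_le _ _).trans (Finset.sum_le_sum fun i hi => ?_)
  rw [norm_mul, norm_pow]
  gcongr
  exact (pow_le_pow_left₀ (norm_nonneg _) hz _).trans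
    (pow_le_pow_right₀ hy (by simpa [Nat.lt_succ_iff] using hi))

open Polynomial in
theorem tendsto_eval_sub_div_pow {p : ℂ[X]} {m : ℕ} (hp : p.natDegree ≤ m) (t : ℝ) :
    Tendsto (fun x : ℝ => p.eval ((x - t : ℝ) : ℂ) / (x : ℂ) ^ m) atTop (𝓝 (p.coeff m)) := by
  have h0 : Tendsto (fun x : ℝ => ((x - t : ℝ) : ℂ) / x) atTop (𝓝 1) := by
    have h : Tendsto (fun x : ℝ => 1 - t * x⁻¹) atTop (𝓝 (1 - t * 0)) :=
      (tendsto_inv_atTop_zero.const_mul t).const_sub 1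
    rw [mul_zero, sub_zero] at h
    have h' := (Complex.continuous_ofReal.tendsto 1).comp h
    rw [Complex.ofReal_one] at h'
    refine h'.congr' ?_
    filter_upwards [eventually_gt_atTop 0] with x hx
    simp only [Function.comp]
    rw [← Complex.ofReal_div]
    congr 1
    field_simp
  have h1 : Tendsto (fun x : ℝ => ((x : ℂ))⁻¹) atTop (𝓝 0) := by
    have h' := (Complex.continuous_ofReal.tendsto 0).comp tendsto_inv_atTop_zero
    simpa [Function.comp_def] using h'
  have h2 : Tendsto (fun x : ℝ => ∑ i ∈ Finset.range (m + 1),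
      p.coeff i * ((((x - t : ℝ) : ℂ) / x) ^ i * ((x : ℂ)⁻¹) ^ (m - i))) atTop
      (𝓝 (∑ i ∈ Finset.range (m + 1), p.coeff i * (1 ^ i * 0 ^ (m - i)))) :=
    tendsto_finsetSum _ fun i _ => ((h0.pow i).mul (h1.pow (m - i))).const_mul _
  have h3 : ∑ i ∈ Finset.range (m + 1), p.coeff i * (1 ^ i * 0 ^ (m - i)) = p.coeff m := by
    rw [Finset.sum_eq_single m]
    · simp
    · intro i hi him
      rw [Finset.mem_range] at hi
      rw [zero_pow (by omega)]; simp
    · simp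
  rw [h3] at h2
  refine h2.congr' ?_
  filter_upwards [eventually_gt_atTop 0] with x hx
  have hx' : (x : ℂ) ≠ 0 := Complex.ofReal_ne_zero.2 hx.ne'
  rw [eval_eq_sum_range' (Nat.lt_succ_of_le hp), Finset.sum_div]
  refine Finset.sum_congr rfl fun i hi => ?_
  have : (x : ℂ) ^ m = (x : ℂ) ^ i * (x : ℂ) ^ (m - i) := by
    rw [← pow_add]; congr 1; rw [Finset.mem_range] at hi; omega
  rw [this, div_pow, inv_pow]
  field_simp

/-- If the Riesz sums grow at most like `exp (c * x)`, then the Riesz means converge on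
`[Re > c]` to the corresponding Laplace integral. -/
theorem tendsto_rieszMean_of_norm_rieszSum_le {lam : ℕ → ℝ} (hlam : IsFrequency lam) {m : ℕ}
    (hm : m ≠ 0) {a : ℕ → ℂ} {C c : ℝ}
    (hA : ∀ t, ‖rieszSum lam m a t‖ ≤ C * Real.exp (c * t)) {s : ℂ} (hs : c < s.re) :
    Tendsto (fun x : ℝ => rieszMean lam m a x s) atTop (𝓝 (s ^ (m + 1) / (m.factorial : ℂ) *
      ∫ t : ℝ, rieszSum lam m a t * Complex.exp (-s * t))) := by
  obtain ⟨p, hp1, hp2, hp3⟩ := exists_polynomial_rieszSum_mul_exp hlam hm s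
  have hcont := continuous_rieszSum hlam hm a
  have hint := integrable_rieszSum_mul_exp hlam hm hA hs
  set D := ∑ i ∈ Finset.range (m + 1), ‖p.coeff i‖ with hD
  -- The boundary term of the convolution formula decays since `c < Re s`.
  have lim1 : Tendsto (fun x : ℝ => Complex.exp (-s * x) * rieszSum lam m a x / (x : ℂ) ^ m)
      atTop (𝓝 0) := by
    have hexp : Tendsto (fun x : ℝ => C * Real.exp ((c - s.re) * x)) atTop (𝓝 0) := by
      have h1 : Tendsto (fun x : ℝ => (c - s.re) * x) atTop atBot :=
        tendsto_id.const_mul_atTop_of_neg (by linarith)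
      simpa using (Real.tendsto_exp_atBot.comp h1).const_mul C
    refine squeeze_zero_norm' ?_ hexp
    filter_upwards [eventually_ge_atTop 1] with x hx
    rw [norm_div, norm_mul, norm_pow, Complex.norm_real, Real.norm_of_nonneg (by linarith),
      Complex.norm_exp]
    refine (div_le_self (by positivity) (one_le_pow₀ hx)).trans ?_
    calc _ ≤ Real.exp (-s * x : ℂ).re * (C * Real.exp (c * x)) := by gcongr; exact hA x
      _ = _ := by
        rw [mul_left_comm, ← Real.exp_add]
        congr 2
        simp; ring
  -- For `x ≥ 1` and `0 < t ≤ x` the quotient of the polynomial by `x ^ m` is at most `D`; as `x →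
  -- ∞` it tends to the leading coefficient `s ^ (m + 1) / m!`.
  have lim2 : Tendsto (fun x : ℝ => ∫ t : ℝ, (Set.Ioc 0 x).indicator (fun t : ℝ =>
      rieszSum lam m a t * Complex.exp (-s * t) * (p.eval ((x - t : ℝ) : ℂ) / (x : ℂ) ^ m)) t)
      atTop (𝓝 (∫ t : ℝ, rieszSum lam m a t * Complex.exp (-s * t) * p.coeff m)) := by
    refine tendsto_integral_filter_of_dominated_convergence
      (fun t => ‖rieszSum lam m a t * Complex.exp (-s * t)‖ * D) ?_ ?_ (hint.norm.mul_const _) ?_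
    · refine Eventually.of_forall fun x => AEStronglyMeasurable.indicator ?_ measurableSet_Ioc
      have := p.continuous
      exact Continuous.aestronglyMeasurable (by fun_prop)
    · filter_upwards [eventually_ge_atTop 1] with x hx
      refine ae_of_all _ fun t => ?_
      rw [Set.indicator_apply]
      split_ifs with ht
      · rw [norm_mul]
        gcongr
        rw [norm_div, norm_pow, Complex.norm_real, Real.norm_of_nonneg (by linarith : 0 ≤ x),
          div_le_iff₀ (by positivity)]
        refine norm_eval_le_of_natDegree_le hp1 hx ?_
        rw [Complex.norm_real, Real.norm_of_nonneg (by linarith [ht.2])]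
        linarith [ht.1]
      · rw [norm_zero]
        exact mul_nonneg (norm_nonneg _) (Finset.sum_nonneg fun _ _ => norm_nonneg _)
    · refine ae_of_all _ fun t => ?_
      rcases le_or_gt t 0 with ht | ht
      · rw [rieszSum_of_nonpos hlam hm a ht, zero_mul, zero_mul]
        refine tendsto_const_nhds.congr fun x => ?_
        rw [Set.indicator_of_notMem]
        exact fun h : t ∈ Set.Ioc 0 x => absurd h.1 (not_lt.2 ht)
      · refine ((tendsto_eval_sub_div_pow hp1 t).const_mul _).congr' ?_
        filter_upwards [eventually_ge_atTop t] with x hx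
        rw [Set.indicator_of_mem (show t ∈ Set.Ioc 0 x from ⟨ht, hx⟩)]
  rw [integral_mul_const, hp2, mul_comm] at lim2
  have lim := lim1.add lim2
  rw [zero_add] at lim
  refine lim.congr' ?_
  filter_upwards [eventually_gt_atTop 0] with x hx
  have hx' : (x : ℂ) ^ m ≠ 0 := pow_ne_zero _ (Complex.ofReal_ne_zero.2 hx.ne')
  rw [← mul_right_inj' hx', pow_mul_rieszMean hlam hm a hx, hp3 a x hx.le, mul_add,
    mul_div_cancel₀ _ hx', integral_indicator measurableSet_Ioc,
    ← intervalIntegral.integral_of_le hx.le, ← intervalIntegral.integral_const_mul]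
  congr 1
  refine intervalIntegral.integral_congr fun t _ => ?_
  field_simp

theorem exists_pow_le_mul_exp (n : ℕ) : ∃ M : ℝ, 0 ≤ M ∧ ∀ x : ℝ, 0 ≤ x →
    (1 + x) ^ n ≤ M * Real.exp x := by
  refine ⟨n.factorial * Real.exp 1, by positivity, fun x hx => ?_⟩
  have := Real.pow_div_factorial_le_exp (1 + x) (by linarith) n
  rw [div_le_iff₀ (by positivity), Real.exp_add] at this
  linarith

/-- Convergence of the Riesz means at a point `s` bounds the growth of the Riesz sums. -/
theorem exists_norm_rieszSum_le {lam : ℕ → ℝ} (hlam : IsFrequency lam) {m : ℕ} (hm : m ≠ 0)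
    {a : ℕ → ℂ} {s : ℝ} (hs : 0 ≤ s) {L : ℂ}
    (h : Tendsto (fun x : ℝ => rieszMean lam m a x s) atTop (𝓝 L)) :
    ∃ C, ∀ x, ‖rieszSum lam m a x‖ ≤ C * Real.exp ((s + 1) * x) := by
  obtain ⟨C, hC⟩ := exists_norm_rieszMean_le hlam (Nat.cast_nonneg m) h
  have hC0 : 0 ≤ C := (norm_nonneg _).trans (hC 0)
  -- The convolution formula at `-s`, applied to the damped coefficients `b`, recovers `a`.
  obtain ⟨p, hp1, -, hp3⟩ := exists_polynomial_rieszSum_mul_exp hlam hm (-(s : ℂ))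
  set D := ∑ i ∈ Finset.range (m + 1), ‖p.coeff i‖ with hD
  have hD0 : 0 ≤ D := Finset.sum_nonneg fun _ _ => norm_nonneg _
  -- The exponent collects `m` from the Riesz sum of `b`, `m` from the polynomial and `1` from the
  -- length of the interval; the extra `exp x` absorbs this power.
  obtain ⟨M, hM0, hM⟩ := exists_pow_le_mul_exp (2 * m + 1)
  set b : ℕ → ℂ := fun n => a n * Complex.exp (-(lam n : ℂ) * s) with hb
  have hbB (t : ℝ) (ht : 0 ≤ t) : ‖rieszSum lam m b t‖ ≤ C * t ^ m := by
    rcases ht.eq_or_lt with rfl | ht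
    · rw [rieszSum_of_nonpos hlam hm b le_rfl, zero_pow hm]; simp
    · rw [← pow_mul_rieszMean hlam hm a ht, norm_mul, norm_pow, Complex.norm_real,
        Real.norm_of_nonneg ht.le, mul_comm]
      gcongr
      exact hC t
  have hba : (fun n => b n * Complex.exp (-(lam n : ℂ) * -(s : ℂ))) = a := by
    funext n
    rw [hb, mul_assoc, ← Complex.exp_add]
    simp
  refine ⟨(C + C * D) * M, fun x => ?_⟩
  rcases le_total x 0 with hx | hx
  · rw [rieszSum_of_nonpos hlam hm a hx, norm_zero]; positivity
  have key := hp3 b x hx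
  rw [hba, neg_neg] at key
  have hexp (t : ℝ) : ‖Complex.exp (s * t)‖ = Real.exp (s * t) := by
    rw [Complex.norm_exp]; simp
  have h2 : ‖∫ t in (0 : ℝ)..x, rieszSum lam m b t *
      (Complex.exp (s * t) * p.eval ((x - t : ℝ) : ℂ))‖ ≤
      C * x ^ m * (Real.exp (s * x) * (D * (1 + x) ^ m)) * |x - 0| := by
    refine intervalIntegral.norm_integral_le_of_norm_le_const fun t ht => ?_
    rw [Set.uIoc_of_le hx] at ht
    rw [norm_mul, norm_mul, hexp]
    have h3 : ‖p.eval ((x - t : ℝ) : ℂ)‖ ≤ D * (1 + x) ^ m := by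
      refine norm_eval_le_of_natDegree_le hp1 (by linarith) ?_
      rw [Complex.norm_real, Real.norm_of_nonneg (by linarith [ht.2])]
      linarith [ht.1]
    have h4 : ‖rieszSum lam m b t‖ ≤ C * x ^ m := by
      refine (hbB t ht.1.le).trans ?_
      gcongr
      · exact ht.1.le
      · exact ht.2
    have h5 := ht.2
    gcongr
  rw [sub_zero, abs_of_nonneg hx] at h2
  rw [key]
  refine (norm_add_le _ _).trans ?_
  rw [norm_mul, hexp]
  have h6 : x ^ m ≤ (1 + x) ^ (2 * m + 1) :=
    (pow_le_pow_left₀ hx (by linarith) m).trans (pow_le_pow_right₀ (by linarith) (by omega))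
  have h7 : x ^ m * (1 + x) ^ m * x ≤ (1 + x) ^ (2 * m + 1) := by
    calc _ ≤ (1 + x) ^ m * (1 + x) ^ m * (1 + x) := by gcongr <;> linarith
      _ = _ := by ring
  calc _ ≤ Real.exp (s * x) * (C * x ^ m) +
        C * x ^ m * (Real.exp (s * x) * (D * (1 + x) ^ m)) * x := by
        gcongr
        exact hbB x hx
    _ = Real.exp (s * x) * (C * x ^ m + C * D * (x ^ m * (1 + x) ^ m * x)) := by ring
    _ ≤ Real.exp (s * x) * (C * (M * Real.exp x) + C * D * (M * Real.exp x)) := by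
        refine mul_le_mul_of_nonneg_left (add_le_add ?_ ?_) (Real.exp_pos _).le
        · exact mul_le_mul_of_nonneg_left (h6.trans (hM x hx)) hC0
        · exact mul_le_mul_of_nonneg_left (h7.trans (hM x hx)) (mul_nonneg hC0 hD0)
    _ = _ := by rw [add_mul s, Real.exp_add, one_mul]; ring

/-! ### Fourier inversion and shifting of contours -/

/-- Fourier inversion with angular frequency. -/
theorem eq_integral_of_fourier_integrable {g : ℝ → ℂ} (hg : Continuous g) (hgi : Integrable g)
    (hG : Integrable fun t : ℝ => ∫ x : ℝ, Complex.exp (-(t * x) * Complex.I) * g x) (x : ℝ) :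
    g x = (2 * Real.pi : ℂ)⁻¹ * ∫ t : ℝ, Complex.exp (t * x * Complex.I) *
      ∫ y : ℝ, Complex.exp (-(t * y) * Complex.I) * g y := by
  set G : ℝ → ℂ := fun t => ∫ x : ℝ, Complex.exp (-(t * x) * Complex.I) * g x with hGdef
  have hpi : (2 * Real.pi) ≠ 0 := by positivity
  have h1 : FourierTransform.fourier g = fun ξ : ℝ => G (2 * Real.pi * ξ) := by
    funext ξ
    rw [Real.fourier_real_eq_integral_exp_smul]
    refine integral_congr_ae (ae_of_all _ fun v => ?_)
    simp only [smul_eq_mul]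
    congr 2
    push_cast; ring
  have h2 := congr_fun (hg.fourierInv_fourier_eq hgi
    (by rw [h1]; exact hG.comp_mul_left' hpi)) x
  rw [← h2, h1, Real.fourierInv_eq']
  have h3 := Measure.integral_comp_mul_left (fun t : ℝ => Complex.exp (t * x * Complex.I) * G t)
    (2 * Real.pi)
  rw [abs_of_pos (by positivity), Complex.real_smul] at h3
  push_cast at h3
  rw [← h3]
  refine integral_congr_ae (ae_of_all _ fun v => ?_)
  simp only [smul_eq_mul, RCLike.inner_apply, conj_trivial]
  congr 2
  push_cast; ring

/-- Fourier inversion with angular frequency, in the other direction. -/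
theorem eq_integral_of_fourierInv_integrable {G : ℝ → ℂ} (hG : Continuous G) (hGi : Integrable G)
    {g : ℝ → ℂ} (hg : ∀ x, g x = (2 * Real.pi : ℂ)⁻¹ * ∫ t : ℝ,
      Complex.exp (t * x * Complex.I) * G t) (hgi : Integrable g) (t : ℝ) :
    G t = ∫ x : ℝ, Complex.exp (-(t * x) * Complex.I) * g x := by
  have hpi : (2 * Real.pi : ℂ) ≠ 0 := by
    have := Real.pi_ne_zero
    simp [this]
  -- Inversion for `G` itself: its transform at `x` is `2π * g (-x)`, hence the reflection.
  have h1 := eq_integral_of_fourier_integrable hG hGi (x := t) ?_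
  · rw [h1, ← integral_const_mul, ← integral_neg_eq_self]
    refine integral_congr_ae (ae_of_all _ fun x => ?_)
    simp only [Complex.ofReal_neg]
    rw [hg]
    simp only [neg_mul, neg_neg, mul_comm (x : ℂ)]
    ring_nf
  · refine ((hgi.comp_neg).const_mul (2 * Real.pi : ℂ)).congr (ae_of_all _ fun x => ?_)
    simp only
    rw [hg, mul_inv_cancel_left₀ hpi]
    refine integral_congr_ae (ae_of_all _ fun y => ?_)
    simp only
    congr 2
    push_cast; ring

/-- Shifting a vertical line of integration. -/
theorem integral_vertical_eq {H : ℂ → ℂ} {c₀ c₁ B : ℝ} (h01 : c₀ ≤ c₁)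
    (hH : DifferentiableOn ℂ H {s | c₀ ≤ s.re ∧ s.re ≤ c₁})
    (hB : ∀ s : ℂ, c₀ ≤ s.re → s.re ≤ c₁ → ‖H s‖ ≤ B * (1 + s.im ^ 2)⁻¹) :
    ∫ t : ℝ, H (c₀ + t * Complex.I) = ∫ t : ℝ, H (c₁ + t * Complex.I) := by
  have hint (c : ℝ) (h0 : c₀ ≤ c) (h1 : c ≤ c₁) : Integrable fun t : ℝ =>
      H (c + t * Complex.I) := by
    refine Integrable.mono' (integrable_inv_one_add_sq.const_mul B) ?_ (ae_of_all _ fun t => ?_)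
    · refine Continuous.aestronglyMeasurable ?_
      exact hH.continuousOn.comp_continuous (by fun_prop) fun t => by simp [h0, h1]
    · simpa using hB (c + t * Complex.I) (by simpa) (by simpa)
  have hlim (c : ℝ) (h0 : c₀ ≤ c) (h1 : c ≤ c₁) :=
    intervalIntegral_tendsto_integral (hint c h0 h1) tendsto_neg_atTop_atBot tendsto_id
  have hhor (ε : ℝ) (hε : ε ^ 2 = 1) : Tendsto (fun T : ℝ => ∫ x : ℝ in c₀..c₁,
      H (x + (ε * T : ℝ) * Complex.I)) atTop (𝓝 0) := by
    have h2 : Tendsto (fun T : ℝ => B * (1 + T ^ 2)⁻¹ * |c₁ - c₀|) atTop (𝓝 0) := by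
      have : Tendsto (fun T : ℝ => (1 + T ^ 2)) atTop atTop :=
        tendsto_atTop_add_const_left _ _ (tendsto_pow_atTop two_ne_zero)
      simpa using (this.inv_tendsto_atTop.const_mul B).mul_const |c₁ - c₀|
    refine squeeze_zero_norm (fun T => ?_) h2
    refine intervalIntegral.norm_integral_le_of_norm_le_const fun x hx => ?_
    rw [Set.uIoc_of_le h01] at hx
    have := hB (x + (ε * T : ℝ) * Complex.I) (by simpa using hx.1.le) (by simpa using hx.2)
    simpa [mul_pow, hε] using this
  have hrect (T : ℝ) : (∫ x : ℝ in c₀..c₁, H (x + ((-1) * T : ℝ) * Complex.I)) -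
      (∫ x : ℝ in c₀..c₁, H (x + (1 * T : ℝ) * Complex.I)) +
      Complex.I * (∫ t : ℝ in (-T)..T, H (c₁ + t * Complex.I)) -
      Complex.I * (∫ t : ℝ in (-T)..T, H (c₀ + t * Complex.I)) = 0 := by
    have := Complex.integral_boundary_rect_eq_zero_of_differentiableOn H
      ⟨c₀, -T⟩ ⟨c₁, T⟩ (hH.mono fun s hs => ?_)
    · simpa using this
    · have := hs.1
      simp only [Set.mem_preimage, Set.uIcc_of_le h01] at this
      exact this
  have key := (((hhor (-1) (by norm_num)).sub (hhor 1 (by norm_num))).add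
    ((hlim c₁ h01 le_rfl).const_mul Complex.I)).sub ((hlim c₀ le_rfl h01).const_mul Complex.I)
  have key2 := tendsto_nhds_unique key (tendsto_const_nhds.congr fun T => (hrect T).symm)
  rw [sub_zero, zero_add, sub_eq_zero] at key2
  exact (mul_left_cancel₀ Complex.I_ne_zero key2).symm

/-! ### Perron integrals -/

/-- Functions holomorphic on the right half-plane with `‖F s‖ ≤ M * (1 + ‖s‖) ^ ℓ` there. -/
structure HasGrowth (F : ℂ → ℂ) (ℓ M : ℝ) : Prop where
  differentiableOn : DifferentiableOn ℂ F {s | 0 < s.re}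
  norm_le : ∀ s : ℂ, 0 < s.re → ‖F s‖ ≤ M * (1 + ‖s‖) ^ ℓ

theorem HasGrowth.nonneg {F : ℂ → ℂ} {ℓ M : ℝ} (hF : HasGrowth F ℓ M) : 0 ≤ M := by
  have := (norm_nonneg _).trans (hF.norm_le 1 (by simp))
  exact nonneg_of_mul_nonneg_left this (by positivity)

theorem HasGrowth.continuous_vertical {F : ℂ → ℂ} {ℓ M : ℝ} (hF : HasGrowth F ℓ M) {c : ℝ}
    (hc : 0 < c) : Continuous fun t : ℝ => F (c + t * Complex.I) :=
  hF.differentiableOn.continuousOn.comp_continuous (by fun_prop) fun t => by simpa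

/-- The integrand of Perron's formula. -/
def perronKernel (F : ℂ → ℂ) (k : ℕ) (x : ℝ) (s : ℂ) : ℂ :=
  F s / s ^ (k + 1) * Complex.exp (s * x)

/-- The Perron integral along `[Re = c]`. -/
def perron (F : ℂ → ℂ) (k : ℕ) (c x : ℝ) : ℂ :=
  (k.factorial : ℂ) * ((2 * Real.pi : ℂ)⁻¹ * ∫ t : ℝ, perronKernel F k x (c + t * Complex.I))

/-- On `Re s ≥ c` one has `1 + |s| ≤ (1 + 1 / c) * |s|`, and `k + 1 ≥ ℓ + 2` leaves two spare powers
of `|s|` for decay along vertical lines. -/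
theorem HasGrowth.norm_div_pow_le {F : ℂ → ℂ} {ℓ M : ℝ} (hF : HasGrowth F ℓ M) {k : ℕ}
    (hk : ℓ + 1 ≤ k) (hk0 : k ≠ 0) {c : ℝ} (hc : 0 < c) {s : ℂ} (hs : c ≤ s.re) :
    ‖F s / s ^ (k + 1)‖ ≤ M * (1 + 1 / c) ^ (k + 1) * (1 + s.im ^ 2)⁻¹ := by
  obtain ⟨j, rfl⟩ := Nat.exists_eq_succ_of_ne_zero hk0
  rw [Nat.succ_eq_add_one] at hk ⊢
  have hM := hF.nonneg
  have hs0 : 0 < s.re := hc.trans_le hs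
  have hsn : c ≤ ‖s‖ := hs.trans (Complex.re_le_norm s)
  have hsn0 : 0 < ‖s‖ := hc.trans_le hsn
  set E := 1 + 1 / c with hE
  have hE0 : 0 < E := by positivity
  have h1 : 1 + ‖s‖ ≤ E * ‖s‖ := by
    have : 1 ≤ 1 / c * ‖s‖ := by
      rw [one_div, inv_mul_eq_div, one_le_div hc]; exact hsn
    rw [hE, add_mul, one_mul]; linarith
  have h2 : (1 + ‖s‖) ^ ℓ ≤ (E * ‖s‖) ^ j := by
    calc (1 + ‖s‖) ^ ℓ ≤ (1 + ‖s‖) ^ (j : ℝ) :=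
          Real.rpow_le_rpow_of_exponent_le (by linarith) (by push_cast at hk; linarith)
      _ = (1 + ‖s‖) ^ j := Real.rpow_natCast _ _
      _ ≤ _ := pow_le_pow_left₀ (by positivity) h1 _
  have h3 : 1 + s.im ^ 2 ≤ (E * ‖s‖) ^ 2 := by
    have h4 : s.im ^ 2 ≤ ‖s‖ ^ 2 := by
      rw [← sq_abs s.im]
      exact pow_le_pow_left₀ (abs_nonneg _) (Complex.abs_im_le_norm s) 2
    calc 1 + s.im ^ 2 ≤ (1 + ‖s‖) ^ 2 := by nlinarith
      _ ≤ _ := pow_le_pow_left₀ (by positivity) h1 _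
  clear_value E
  rw [norm_div, norm_pow, div_le_iff₀ (by positivity), ← div_eq_mul_inv, div_mul_eq_mul_div,
    le_div_iff₀ (by positivity)]
  calc ‖F s‖ * (1 + s.im ^ 2) ≤ (M * (E * ‖s‖) ^ j) * (E * ‖s‖) ^ 2 := by
        gcongr
        exact (hF.norm_le s hs0).trans (by gcongr)
    _ = M * E ^ (j + 1 + 1) * ‖s‖ ^ (j + 1 + 1) := by
        rw [mul_pow, mul_pow, pow_succ E (j + 1), pow_succ E j, pow_succ ‖s‖ (j + 1), pow_succ ‖s‖ j]
        ring

theorem HasGrowth.integrable_div_pow {F : ℂ → ℂ} {ℓ M : ℝ} (hF : HasGrowth F ℓ M) {k : ℕ}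
    (hk : ℓ + 1 ≤ k) (hk0 : k ≠ 0) {c : ℝ} (hc : 0 < c) :
    Continuous (fun t : ℝ => F (c + t * Complex.I) / (c + t * Complex.I) ^ (k + 1)) ∧
    Integrable fun t : ℝ => F (c + t * Complex.I) / (c + t * Complex.I) ^ (k + 1) := by
  have h : Continuous (fun t : ℝ => F (c + t * Complex.I) / (c + t * Complex.I) ^ (k + 1)) := by
    refine (hF.continuous_vertical hc).div (by fun_prop) fun t => pow_ne_zero _ fun h => ?_
    have := congrArg Complex.re h
    simp at this
    exact hc.ne' this
  refine ⟨h, Integrable.mono' (integrable_inv_one_add_sq.const_mul (M * (1 + 1 / c) ^ (k + 1)))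
    h.aestronglyMeasurable (ae_of_all _ fun t => ?_)⟩
  simpa using hF.norm_div_pow_le hk hk0 hc (s := c + t * Complex.I) (by simp)

theorem norm_perronKernel (F : ℂ → ℂ) (k : ℕ) (x : ℝ) (s : ℂ) :
    ‖perronKernel F k x s‖ = ‖F s / s ^ (k + 1)‖ * Real.exp (s.re * x) := by
  rw [perronKernel, norm_mul, Complex.norm_exp]; simp

theorem HasGrowth.integrable_perronKernel {F : ℂ → ℂ} {ℓ M : ℝ} (hF : HasGrowth F ℓ M) {k : ℕ}
    (hk : ℓ + 1 ≤ k) (hk0 : k ≠ 0) {c : ℝ} (hc : 0 < c) (x : ℝ) :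
    Integrable fun t : ℝ => perronKernel F k x (c + t * Complex.I) := by
  obtain ⟨h1, h2⟩ := hF.integrable_div_pow hk hk0 hc
  refine Integrable.mono' (h2.norm.mul_const (Real.exp (c * x)))
    (h1.mul (by fun_prop)).aestronglyMeasurable (ae_of_all _ fun t => ?_)
  rw [norm_perronKernel]; simp

/-- The Perron integral does not depend on the line of integration. -/
theorem HasGrowth.perron_eq {F : ℂ → ℂ} {ℓ M : ℝ} (hF : HasGrowth F ℓ M) {k : ℕ}
    (hk : ℓ + 1 ≤ k) (hk0 : k ≠ 0) {c c' : ℝ} (hc : 0 < c) (hc' : 0 < c') (x : ℝ) :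
    perron F k c x = perron F k c' x := by
  wlog h : c ≤ c' generalizing c c'
  · exact (this hc' hc (le_of_not_ge h)).symm
  rw [perron, perron]
  congr 2
  -- The factor `exp (c' * |x|)` bounds the exponential on the whole strip for either sign of `x`.
  refine integral_vertical_eq (H := perronKernel F k x)
    (B := M * (1 + 1 / c) ^ (k + 1) * Real.exp (c' * |x|)) h ?_ fun s h0 h1 => ?_
  · intro s hs
    have hs0 : 0 < s.re := hc.trans_le hs.1
    have h1 : DifferentiableAt ℂ F s :=
      hF.differentiableOn.differentiableAt
        ((isOpen_lt continuous_const Complex.continuous_re).mem_nhds hs0)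
    have h2 : s ^ (k + 1) ≠ 0 := pow_ne_zero _ fun h => by simp [h] at hs0
    unfold perronKernel
    exact ((h1.div (by fun_prop) h2).mul (by fun_prop)).differentiableWithinAt
  · rw [norm_perronKernel, mul_right_comm]
    have h2 := hF.norm_div_pow_le hk hk0 hc h0
    have h3 : s.re * x ≤ c' * |x| :=
      (mul_le_mul_of_nonneg_left (le_abs_self x) (hc.le.trans h0)).trans
        (mul_le_mul_of_nonneg_right h1 (abs_nonneg x))
    calc _ ≤ M * (1 + 1 / c) ^ (k + 1) * (1 + s.im ^ 2)⁻¹ * Real.exp (c' * |x|) := by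
          have := hF.nonneg
          gcongr
      _ = _ := by ring

/-- Linearity in `M` is what matters: applied to differences, it makes Perron integrals continuous
in `F`. The `2` is `1 + 1 / c` at `c = 1`. -/
theorem HasGrowth.norm_perron_one_le {F : ℂ → ℂ} {ℓ M : ℝ} (hF : HasGrowth F ℓ M) {k : ℕ}
    (hk : ℓ + 1 ≤ k) (hk0 : k ≠ 0) (x : ℝ) :
    ‖perron F k 1 x‖ ≤ k.factorial * 2 ^ (k + 1) * M * Real.exp x := by
  have h1 : ‖∫ t : ℝ, perronKernel F k x ((1 : ℝ) + t * Complex.I)‖ ≤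
      ∫ t : ℝ, M * 2 ^ (k + 1) * Real.exp x * (1 + t ^ 2)⁻¹ := by
    refine norm_integral_le_of_norm_le (integrable_inv_one_add_sq.const_mul _)
      (ae_of_all _ fun t => ?_)
    rw [norm_perronKernel, mul_right_comm]
    have := hF.norm_div_pow_le hk hk0 one_pos (s := (1 : ℝ) + t * Complex.I) (by simp)
    norm_num at this ⊢
    exact mul_le_mul_of_nonneg_right this (Real.exp_pos x).le
  rw [integral_const_mul, integral_univ_inv_one_add_sq] at h1
  have hpi := Real.pi_pos
  rw [perron, norm_mul, norm_mul, norm_inv]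
  have h2 : ‖(2 * Real.pi : ℂ)‖ = 2 * Real.pi := by
    rw [norm_mul, Complex.norm_real, Real.norm_of_nonneg hpi.le]; simp
  rw [h2, Complex.norm_natCast]
  calc _ ≤ (k.factorial : ℝ) * ((2 * Real.pi)⁻¹ * (M * 2 ^ (k + 1) * Real.exp x * Real.pi)) := by
        gcongr
    _ = (k.factorial * 2 ^ (k + 1) * M * Real.exp x) / 2 := by field_simp
    _ ≤ _ := by
        have := hF.nonneg
        exact half_le_self (by positivity)

/-- Differentiating under the integral cancels one power of `s`; `(k + 1)! = (k + 1) * k!` gives the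
same recursion as for Riesz sums. -/
theorem HasGrowth.hasDerivAt_perron {F : ℂ → ℂ} {ℓ M : ℝ} (hF : HasGrowth F ℓ M) {k : ℕ}
    (hk : ℓ + 1 ≤ k) (hk0 : k ≠ 0) {c : ℝ} (hc : 0 < c) (x : ℝ) :
    HasDerivAt (perron F (k + 1) c) ((k + 1) * perron F k c x) x := by
  have hk' : ℓ + 1 ≤ (k + 1 : ℕ) := by push_cast; linarith
  obtain ⟨h1, h2⟩ := hF.integrable_div_pow hk hk0 hc
  have hne (t : ℝ) : (c + t * Complex.I : ℂ) ≠ 0 := fun h => by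
    have := congrArg Complex.re h
    simp at this
    exact hc.ne' this
  have key := (hasDerivAt_integral_of_dominated_loc_of_deriv_le (μ := volume)
    (F := fun (x : ℝ) (t : ℝ) => perronKernel F (k + 1) x (c + t * Complex.I))
    (F' := fun (x : ℝ) (t : ℝ) => perronKernel F k x (c + t * Complex.I)) (x₀ := x)
    (bound := fun t : ℝ => ‖F (c + t * Complex.I) / (c + t * Complex.I) ^ (k + 1)‖ *
      Real.exp (c * (x + 1)))
    (Iio_mem_nhds (lt_add_one x))
    (Eventually.of_forall fun y =>
      (hF.integrable_perronKernel hk' (k.succ_ne_zero) hc y).aestronglyMeasurable)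
    (hF.integrable_perronKernel hk' (k.succ_ne_zero) hc x)
    (hF.integrable_perronKernel hk hk0 hc x).aestronglyMeasurable
    (ae_of_all _ fun t y hy => ?_) (h2.norm.mul_const _) (ae_of_all _ fun t y _ => ?_)).2
  · have := (key.const_mul (2 * Real.pi : ℂ)⁻¹).const_mul ((k + 1).factorial : ℂ)
    refine this.congr_deriv ?_
    rw [perron, Nat.factorial_succ]
    push_cast; ring
  · rw [norm_perronKernel]
    have hy' : y ≤ x + 1 := le_of_lt hy
    simp only [Complex.add_re, Complex.ofReal_re, Complex.mul_re, Complex.I_re, mul_zero,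
      Complex.ofReal_im, Complex.I_im, mul_one, sub_self, add_zero]
    gcongr
  · unfold perronKernel
    set s : ℂ := c + t * Complex.I with hs
    have h3 : HasDerivAt (fun z : ℂ => F s / s ^ (k + 1 + 1) * Complex.exp (s * z))
        (F s / s ^ (k + 1) * Complex.exp (s * y)) (y : ℂ) := by
      have h4 : HasDerivAt (fun z : ℂ => s * z) s (y : ℂ) := by
        simpa using (hasDerivAt_id (y : ℂ)).const_mul s
      refine (h4.cexp.const_mul _).congr_deriv ?_
      have := hne t
      rw [← hs] at this
      field_simp
      ring
    exact h3.comp_ofReal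

/-- Since `k + 1 ≥ 2`, the kink at `l` is flattened. -/
theorem hasDerivAt_max_sub_pow {k : ℕ} (hk : k ≠ 0) (l x : ℝ) :
    HasDerivAt (fun x : ℝ => max (x - l) 0 ^ (k + 1)) ((k + 1) * max (x - l) 0 ^ k) x := by
  rcases lt_trichotomy x l with h | rfl | h
  · rw [max_eq_right (by linarith), zero_pow hk, mul_zero]
    refine (hasDerivAt_const x (0 : ℝ)).congr_of_eventuallyEq ?_
    filter_upwards [eventually_lt_nhds h] with y hy
    rw [max_eq_right (by linarith), zero_pow k.succ_ne_zero]
  · rw [sub_self, max_self, zero_pow hk, mul_zero, hasDerivAt_iff_isLittleO]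
    simp only [sub_self, max_self, zero_pow k.succ_ne_zero, sub_zero, smul_zero]
    have h1 : (fun y : ℝ => (y - x) ^ (k + 1)) =o[𝓝 x] fun y => y - x := by
      have h2 : Tendsto (fun y : ℝ => y - x) (𝓝 x) (𝓝 0) := by
        simpa using (tendsto_id (x := 𝓝 x)).sub_const x
      exact (Asymptotics.isLittleO_pow_id (𝕜 := ℝ) (n := k + 1) (by omega)).comp_tendsto h2
    refine Asymptotics.IsBigO.trans_isLittleO (Asymptotics.IsBigO.of_bound 1
      (Eventually.of_forall fun y => ?_)) h1
    rw [norm_pow, norm_pow, one_mul]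
    refine pow_le_pow_left₀ (norm_nonneg _) ?_ _
    rw [Real.norm_eq_abs, Real.norm_eq_abs, abs_of_nonneg (le_max_right _ _)]
    exact max_le (le_abs_self _) (abs_nonneg _)
  · rw [max_eq_left (by linarith)]
    have h1 := ((hasDerivAt_id x).sub_const l).pow (k + 1)
    refine (h1.congr_deriv (by simp)).congr_of_eventuallyEq ?_
    filter_upwards [eventually_gt_nhds h] with y hy
    rw [max_eq_left (by linarith)]
    rfl

theorem hasDerivAt_rieszSum {lam : ℕ → ℝ} (hlam : IsFrequency lam) {k : ℕ} (hk : k ≠ 0)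
    (a : ℕ → ℂ) (x : ℝ) :
    HasDerivAt (rieszSum lam (k + 1) a) ((k + 1) * rieszSum lam k a x) x := by
  obtain ⟨N, hN⟩ := hlam.exists_forall_le (x + 1)
  have h1 : HasDerivAt (fun x : ℝ => ∑ n ∈ Finset.range N,
      a n * ((max (x - lam n) 0 ^ (k + 1) : ℝ) : ℂ))
      (∑ n ∈ Finset.range N, a n * (((k + 1) * max (x - lam n) 0 ^ k : ℝ) : ℂ)) x :=
    HasDerivAt.fun_sum fun n _ => ((hasDerivAt_max_sub_pow hk (lam n) x).ofReal_comp).const_mul _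
  refine (h1.congr_deriv ?_).congr_of_eventuallyEq ?_
  · rw [rieszSum_eq_sum hN hk a (by linarith), Finset.mul_sum]
    refine Finset.sum_congr rfl fun n _ => ?_
    push_cast; ring
  · filter_upwards [eventually_lt_nhds (lt_add_one x)] with z hz
    exact rieszSum_eq_sum hN k.succ_ne_zero a hz.le

/-! ### Perron's formula and its converse -/

/-- Perron's formula on a line far to the right, for Riesz means of a natural order. -/
theorem exists_rieszSum_eq_perron {lam : ℕ → ℝ} (hlam : IsFrequency lam) {F : ℂ → ℂ} {ℓ M : ℝ}
    (hF : HasGrowth F ℓ M) {m : ℕ} (hm : ℓ + 1 ≤ m) (hm0 : m ≠ 0) {a : ℕ → ℂ} {σ : ℝ}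
    (h : ∀ s : ℂ, 0 < s.re → σ < s.re →
      Tendsto (fun x : ℝ => rieszMean lam m a x s) atTop (𝓝 (F s))) :
    ∃ c, 0 < c ∧ ∀ x, rieszSum lam m a x = perron F m c x := by
  set b : ℝ := max σ 0 + 1 with hb
  have hb0 : 0 < b := by positivity
  have hbσ : σ < b := (le_max_left σ 0).trans_lt (lt_add_one _)
  obtain ⟨C, hC⟩ := exists_norm_rieszSum_le hlam hm0 hb0.le (h b (by simpa) (by simpa))
  -- Convergence at `b` gives growth of rate `b + 1`, so any `c > b + 1` makes `g` integrable.
  set c : ℝ := b + 2 with hc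
  have hc0 : 0 < c := by positivity
  refine ⟨c, hc0, fun x => ?_⟩
  have hfac : (m.factorial : ℂ) ≠ 0 := by exact_mod_cast m.factorial_ne_zero
  set g : ℝ → ℂ := fun t => rieszSum lam m a t * Complex.exp (-(c : ℂ) * t) with hg
  have hgc : Continuous g := by
    have := continuous_rieszSum hlam hm0 a
    fun_prop
  have hgi : Integrable g := integrable_rieszSum_mul_exp hlam hm0 hC (by simp [hc])
  have hG (t : ℝ) : ∫ x : ℝ, Complex.exp (-(t * x) * Complex.I) * g x =
      m.factorial * (F (c + t * Complex.I) / (c + t * Complex.I) ^ (m + 1)) := by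
    have hre : (c + t * Complex.I : ℂ).re = c := by simp
    have hne : (c + t * Complex.I : ℂ) ≠ 0 := fun h => by
      rw [h] at hre; exact hc0.ne hre
    have h1 := tendsto_nhds_unique
      (h (c + t * Complex.I) (by rw [hre]; exact hc0) (by rw [hre]; linarith))
      (tendsto_rieszMean_of_norm_rieszSum_le hlam hm0 hC (by rw [hre]; linarith))
    rw [h1]
    field_simp
    refine integral_congr_ae (ae_of_all _ fun x => ?_)
    simp only [hg]
    rw [mul_left_comm, ← Complex.exp_add]
    congr 2
    ring
  have key := eq_integral_of_fourier_integrable hgc hgi (by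
    simp_rw [hG]
    exact (hF.integrable_div_pow hm hm0 hc0).2.const_mul _) x
  simp_rw [hG] at key
  have h2 : rieszSum lam m a x = g x * Complex.exp (c * x) := by
    rw [hg]
    simp only
    rw [mul_assoc, ← Complex.exp_add]
    simp
  rw [h2, key, perron, ← integral_const_mul, ← integral_const_mul, ← integral_const_mul,
    ← integral_mul_const]
  refine integral_congr_ae (ae_of_all _ fun t => ?_)
  simp only [perronKernel]
  rw [add_mul (c : ℂ), Complex.exp_add, mul_right_comm (t : ℂ)]
  ring

/-- Perron's formula on the line `[Re = 1]`, for every natural order `k ≥ ℓ + 1`, irrespective of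
the order of the Riesz germ. -/
theorem rieszSum_eq_perron {lam : ℕ → ℝ} (hlam : IsFrequency lam) {F : ℂ → ℂ} {ℓ M : ℝ}
    (hF : HasGrowth F ℓ M) {k : ℕ} (hk : ℓ + 1 ≤ k) (hk0 : k ≠ 0) {a : ℕ → ℂ} {m σ : ℝ}
    (hm : 0 ≤ m) (h : ∀ s : ℂ, 0 < s.re → σ < s.re →
      Tendsto (fun x : ℝ => rieszMean lam m a x s) atTop (𝓝 (F s))) (x : ℝ) :
    rieszSum lam k a x = perron F k 1 x := by
  obtain ⟨j, hj⟩ := exists_nat_ge (m + 1)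
  have hkj : ℓ + 1 ≤ (k + j : ℕ) := by
    push_cast; have : (0 : ℝ) ≤ j := j.cast_nonneg
    linarith
  obtain ⟨c, hc, hcx⟩ := exists_rieszSum_eq_perron hlam hF hkj (by omega) (a := a) (σ := σ)
    fun s hs hs' => tendsto_rieszMean_of_le hlam hm
      (by push_cast; have : (0 : ℝ) ≤ k := k.cast_nonneg
          linarith) (h s hs hs')
  have hcx' : rieszSum lam (k + j) a = perron F (k + j) 1 :=
    funext fun x => (hcx x).trans (hF.perron_eq hkj (by omega) hc one_pos x)
  clear hj hkj hcx
  suffices rieszSum lam k a = perron F k 1 from congrFun this x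
  -- Descent: if the formula holds at order `k + j + 1`, comparing derivatives gives it at order `k
  -- + j`.
  induction j with
  | zero => exact hcx'
  | succ j ih =>
    refine ih (funext fun y => ?_)
    have hkj : ℓ + 1 ≤ (k + j : ℕ) := by
      push_cast; have : (0 : ℝ) ≤ j := j.cast_nonneg
      linarith
    have h1 := hasDerivAt_rieszSum hlam (k := k + j) (by omega) a y
    rw [show k + j + 1 = k + (j + 1) from rfl, hcx'] at h1
    have h2 := h1.unique (hF.hasDerivAt_perron hkj (by omega) one_pos y)
    exact mul_left_cancel₀ (by exact_mod_cast (k + j).succ_ne_zero) h2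

/-- The converse: Perron's formula implies that the Dirichlet series is a Riesz germ. -/
theorem tendsto_rieszMean_of_rieszSum_eq_perron {lam : ℕ → ℝ} (hlam : IsFrequency lam)
    {F : ℂ → ℂ} {ℓ M : ℝ} (hF : HasGrowth F ℓ M) {k : ℕ} (hk : ℓ + 1 ≤ k) (hk0 : k ≠ 0)
    {a : ℕ → ℂ} (h : ∀ x, rieszSum lam k a x = perron F k 1 x) {s : ℂ} (hs : 1 < s.re) :
    Tendsto (fun x : ℝ => rieszMean lam k a x s) atTop (𝓝 (F s)) := by
  have hs0 : 0 < s.re := one_pos.trans hs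
  have hA (x : ℝ) : ‖rieszSum lam k a x‖ ≤ k.factorial * 2 ^ (k + 1) * M * Real.exp (1 * x) := by
    rw [h, one_mul]; exact hF.norm_perron_one_le hk hk0 x
  have key := tendsto_rieszMean_of_norm_rieszSum_le hlam hk0 hA hs
  suffices F s = s ^ (k + 1) / (k.factorial : ℂ) *
      ∫ t : ℝ, rieszSum lam k a t * Complex.exp (-s * t) by rwa [this]
  have hfac : (k.factorial : ℂ) ≠ 0 := by exact_mod_cast k.factorial_ne_zero
  have hpow : s ^ (k + 1) ≠ 0 := pow_ne_zero _ fun h => by simp [h] at hs0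
  obtain ⟨hc, hi⟩ := hF.integrable_div_pow hk hk0 hs0
  have h1 := eq_integral_of_fourierInv_integrable (hc.const_mul (k.factorial : ℂ))
    (hi.const_mul (k.factorial : ℂ))
    (g := fun x => rieszSum lam k a x * Complex.exp (-(s.re : ℂ) * x)) (fun x => ?_)
    (integrable_rieszSum_mul_exp hlam hk0 hA (by simpa using hs)) s.im
  · rw [Complex.re_add_im] at h1
    have h2 : ∫ t : ℝ, rieszSum lam k a t * Complex.exp (-s * t) =
        ∫ x : ℝ, Complex.exp (-(s.im * x) * Complex.I) *
          (rieszSum lam k a x * Complex.exp (-(s.re : ℂ) * x)) := by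
      refine integral_congr_ae (ae_of_all _ fun x => ?_)
      simp only
      rw [mul_left_comm, ← Complex.exp_add]
      congr 2
      conv_lhs => rw [← Complex.re_add_im s]
      ring
    rw [h2, ← h1]
    field_simp
  · rw [h, hF.perron_eq hk hk0 one_pos hs0, perron, ← integral_const_mul, ← integral_const_mul,
      ← integral_const_mul, ← integral_mul_const]
    refine integral_congr_ae (ae_of_all _ fun t => ?_)
    simp only [perronKernel]
    have : Complex.exp (t * x * Complex.I) =
        Complex.exp ((s.re + t * Complex.I) * x) * Complex.exp (-(s.re : ℂ) * x) := by
      rw [← Complex.exp_add]; congr 1; ring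
    rw [this]
    ring

/-! ### The linear space -/

theorem rieszMean_add {lam : ℕ → ℝ} (hlam : IsFrequency lam) (m : ℝ) (a b : ℕ → ℂ) (x : ℝ)
    (s : ℂ) : rieszMean lam m (a + b) x s = rieszMean lam m a x s + rieszMean lam m b x s := by
  obtain ⟨N, hN⟩ := hlam.exists_forall_le x
  simp only [rieszMean_eq_sum hN _ _ le_rfl, ← Finset.sum_add_distrib, Pi.add_apply, add_mul]

theorem rieszMean_smul {lam : ℕ → ℝ} (hlam : IsFrequency lam) (m : ℝ) (c : ℂ) (a : ℕ → ℂ) (x : ℝ)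
    (s : ℂ) : rieszMean lam m (c • a) x s = c * rieszMean lam m a x s := by
  obtain ⟨N, hN⟩ := hlam.exists_forall_le x
  simp only [rieszMean_eq_sum hN _ _ le_rfl, Finset.mul_sum, Pi.smul_apply, smul_eq_mul, mul_assoc]

/-- The two germs may have different orders; consistency moves both to a common one. -/
theorem IsRieszGerm.add {lam : ℕ → ℝ} (hlam : IsFrequency lam) {a b : ℕ → ℂ}
    {f g : RightHalfPlane → ℂ} (hf : IsRieszGerm lam a f) (hg : IsRieszGerm lam b g) :
    IsRieszGerm lam (a + b) (f + g) := by
  obtain ⟨m, hm, σ, h⟩ := hf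
  obtain ⟨m', hm', σ', h'⟩ := hg
  refine ⟨max m m' + 1, by positivity, max σ σ', fun s hs => ?_⟩
  simp only [rieszMean_add hlam, Pi.add_apply]
  exact (tendsto_rieszMean_of_le hlam hm (by gcongr; exact le_max_left _ _)
    (h s ((le_max_left _ _).trans_lt hs))).add
    (tendsto_rieszMean_of_le hlam hm' (by gcongr; exact le_max_right _ _)
    (h' s ((le_max_right _ _).trans_lt hs)))

theorem IsRieszGerm.smul {lam : ℕ → ℝ} (hlam : IsFrequency lam) {a : ℕ → ℂ}
    {f : RightHalfPlane → ℂ} (hf : IsRieszGerm lam a f) (c : ℂ) :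
    IsRieszGerm lam (c • a) (c • f) := by
  obtain ⟨m, hm, σ, h⟩ := hf
  refine ⟨m, hm, σ, fun s hs => ?_⟩
  simp only [rieszMean_smul hlam, Pi.smul_apply, smul_eq_mul]
  exact (h s hs).const_mul c

/-- Extension by zero to the whole plane. -/
def extendZero (f : RightHalfPlane → ℂ) : ℂ → ℂ := Function.extend Subtype.val f 0

theorem extendZero_coe (f : RightHalfPlane → ℂ) (s : RightHalfPlane) : extendZero f s = f s :=
  Subtype.val_injective.extend_apply f 0 s

theorem extendZero_of_pos (f : RightHalfPlane → ℂ) {s : ℂ} (hs : 0 < s.re) :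
    extendZero f s = f ⟨s, hs⟩ :=
  extendZero_coe f ⟨s, hs⟩

theorem IsHolomorphic.add {f g : RightHalfPlane → ℂ} (hf : IsHolomorphic f)
    (hg : IsHolomorphic g) : IsHolomorphic (f + g) :=
  (DifferentiableOn.add hf hg).congr fun s hs => by
    change extendZero _ s = extendZero f s + extendZero g s
    simp only [extendZero_of_pos _ hs, Pi.add_apply]

theorem IsHolomorphic.smul {f : RightHalfPlane → ℂ} (hf : IsHolomorphic f) (c : ℂ) :
    IsHolomorphic (c • f) :=
  (DifferentiableOn.const_smul hf c).congr fun s hs => by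
    change extendZero _ s = c • extendZero f s
    simp only [extendZero_of_pos _ hs, Pi.smul_apply]

theorem weightedAbs_le_iff {ℓ : ℝ} {f : RightHalfPlane → ℂ} {s : RightHalfPlane} {M : ℝ} :
    weightedAbs ℓ f s ≤ M ↔ ‖f s‖ ≤ M * (1 + ‖(s : ℂ)‖) ^ ℓ :=
  div_le_iff₀ (by positivity)

theorem weightedAbs_nonneg (ℓ : ℝ) (f : RightHalfPlane → ℂ) (s : RightHalfPlane) :
    0 ≤ weightedAbs ℓ f s := by
  unfold weightedAbs; positivity

theorem weightedAbs_add_le (ℓ : ℝ) (f g : RightHalfPlane → ℂ) (s : RightHalfPlane) :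
    weightedAbs ℓ (f + g) s ≤ weightedAbs ℓ f s + weightedAbs ℓ g s := by
  unfold weightedAbs
  rw [← add_div]
  gcongr
  exact norm_add_le _ _

theorem weightedAbs_smul (ℓ : ℝ) (c : ℂ) (f : RightHalfPlane → ℂ) (s : RightHalfPlane) :
    weightedAbs ℓ (c • f) s = ‖c‖ * weightedAbs ℓ f s := by
  unfold weightedAbs
  rw [Pi.smul_apply, norm_smul, mul_div_assoc]

instance : Nonempty RightHalfPlane := ⟨⟨1, by simp⟩⟩

/-- Membership matters here: the real supremum of an unbounded family defaults to `0`. -/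
theorem HInfty.weightedAbs_le_supNorm {lam : ℕ → ℝ} {ℓ : ℝ} {f : RightHalfPlane → ℂ}
    (hf : f ∈ HInfty lam ℓ) (s : RightHalfPlane) : weightedAbs ℓ f s ≤ supNorm ℓ f :=
  le_ciSup hf.2.2 s

/-- `HInfty lam ℓ` as a linear space. -/
def hInftySubmodule {lam : ℕ → ℝ} (hlam : IsFrequency lam) (ℓ : ℝ) :
    Submodule ℂ (RightHalfPlane → ℂ) where
  carrier := HInfty lam ℓ
  add_mem' := by
    rintro f g ⟨hf, ⟨a, ha⟩, A, hA⟩ ⟨hg, ⟨b, hb⟩, B, hB⟩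
    refine ⟨hf.add hg, ⟨a + b, ha.add hlam hb⟩, A + B, ?_⟩
    rintro _ ⟨s, rfl⟩
    exact (weightedAbs_add_le ℓ f g s).trans (add_le_add (hA ⟨s, rfl⟩) (hB ⟨s, rfl⟩))
  zero_mem' := by
    refine ⟨?_, ⟨0, 0, le_rfl, 0, fun s _ => ?_⟩, 0, ?_⟩
    · refine (differentiableOn_const 0).congr fun s hs => ?_
      exact extendZero_of_pos 0 hs
    · refine tendsto_const_nhds.congr fun x => ?_
      simp [rieszMean]
    · rintro _ ⟨s, rfl⟩
      simp [weightedAbs]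
  smul_mem' := by
    rintro c f ⟨hf, ⟨a, ha⟩, A, hA⟩
    refine ⟨hf.smul c, ⟨c • a, ha.smul hlam c⟩, ‖c‖ * A, ?_⟩
    rintro _ ⟨s, rfl⟩
    simp only [weightedAbs_smul]
    exact mul_le_mul_of_nonneg_left (hA ⟨s, rfl⟩) (norm_nonneg _)

theorem hasGrowth_extendZero {ℓ : ℝ} {f : RightHalfPlane → ℂ} (hf : IsHolomorphic f) {M : ℝ}
    (hM : ∀ s, weightedAbs ℓ f s ≤ M) : HasGrowth (extendZero f) ℓ M where
  differentiableOn := hf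
  norm_le s hs := by
    rw [extendZero_of_pos f hs]
    exact weightedAbs_le_iff.1 (hM ⟨s, hs⟩)

/-! ### Completeness -/

/-- The system is triangular: at `x = lam (n + 1)` only indices up to `n` contribute, and `a n` has
the nonzero factor `(lam (n + 1) - lam n) ^ k`. -/
theorem exists_tendsto_coeff {lam : ℕ → ℝ} (hlam : IsFrequency lam) {k : ℕ} (hk : k ≠ 0)
    {a : ℕ → ℕ → ℂ}
    (h : ∀ x, ∃ L, Tendsto (fun j => rieszSum lam k (a j) x) atTop (𝓝 L)) (n : ℕ) :
    ∃ l, Tendsto (fun j => a j n) atTop (𝓝 l) := by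
  induction n using Nat.strong_induction_on with
  | _ n ih =>
    choose! l hl using ih
    obtain ⟨L, hL⟩ := h (lam (n + 1))
    have hN : ∀ i, n + 1 ≤ i → lam (n + 1) ≤ lam i := fun i hi => hlam.strictMono.monotone hi
    simp only [rieszSum_eq_sum hN hk _ le_rfl, Finset.sum_range_succ] at hL
    set d : ℂ := ((max (lam (n + 1) - lam n) 0 ^ k : ℝ) : ℂ) with hd
    have hd0 : d ≠ 0 := by
      have := hlam.strictMono (Nat.lt_succ_self n)
      rw [hd, Complex.ofReal_ne_zero, max_eq_left (sub_nonneg.2 this.le)]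
      exact pow_ne_zero _ (sub_pos.2 this).ne'
    have h1 : Tendsto (fun j => ∑ i ∈ Finset.range n,
        a j i * ((max (lam (n + 1) - lam i) 0 ^ k : ℝ) : ℂ)) atTop
        (𝓝 (∑ i ∈ Finset.range n, l i * ((max (lam (n + 1) - lam i) 0 ^ k : ℝ) : ℂ))) :=
      tendsto_finsetSum _ fun i hi => (hl i (Finset.mem_range.1 hi)).mul_const _
    refine ⟨_, ((hL.sub h1).div_const d).congr fun j => ?_⟩
    rw [add_sub_cancel_left, mul_div_cancel_right₀ _ hd0]

theorem tendsto_rieszSum {lam : ℕ → ℝ} (hlam : IsFrequency lam) {k : ℕ} (hk : k ≠ 0)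
    {a : ℕ → ℕ → ℂ} {l : ℕ → ℂ} (h : ∀ n, Tendsto (fun j => a j n) atTop (𝓝 (l n))) (x : ℝ) :
    Tendsto (fun j => rieszSum lam k (a j) x) atTop (𝓝 (rieszSum lam k l x)) := by
  obtain ⟨N, hN⟩ := hlam.exists_forall_le x
  simp only [rieszSum_eq_sum hN hk _ le_rfl]
  exact tendsto_finsetSum _ fun i _ => (h i).mul_const _

/-- The constant is the distance `ε`, not `M + M'`, so close functions have close Perron integrals.
-/
theorem HasGrowth.sub {F G : ℂ → ℂ} {ℓ M M' ε : ℝ} (hF : HasGrowth F ℓ M) (hG : HasGrowth G ℓ M')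
    (h : ∀ s : ℂ, 0 < s.re → ‖F s - G s‖ ≤ ε * (1 + ‖s‖) ^ ℓ) : HasGrowth (F - G) ℓ ε :=
  ⟨hF.differentiableOn.sub hG.differentiableOn, h⟩

theorem HasGrowth.perron_sub {F G : ℂ → ℂ} {ℓ M M' : ℝ} (hF : HasGrowth F ℓ M)
    (hG : HasGrowth G ℓ M') {k : ℕ} (hk : ℓ + 1 ≤ k) (hk0 : k ≠ 0) {c : ℝ} (hc : 0 < c) (x : ℝ) :
    perron (F - G) k c x = perron F k c x - perron G k c x := by
  unfold perron
  rw [← mul_sub, ← mul_sub, ← integral_sub (hF.integrable_perronKernel hk hk0 hc x)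
    (hG.integrable_perronKernel hk hk0 hc x)]
  congr 2
  refine integral_congr_ae (ae_of_all _ fun t => ?_)
  simp only [perronKernel, Pi.sub_apply]
  ring

/-- `HInfty lam ℓ` is closed under limits with respect to the weighted supremum norm. -/
theorem HInfty.mem_of_tendsto {lam : ℕ → ℝ} (hlam : IsFrequency lam) {ℓ : ℝ} (hℓ : 0 ≤ ℓ)
    {u : ℕ → RightHalfPlane → ℂ} (hu : ∀ n, u n ∈ HInfty lam ℓ) {f : RightHalfPlane → ℂ}
    (h : ∀ ε > 0, ∃ N, ∀ n ≥ N, ∀ s, weightedAbs ℓ (u n - f) s ≤ ε) : f ∈ HInfty lam ℓ := by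
  have hdist {n : ℕ} {ε : ℝ} (hn : ∀ s, weightedAbs ℓ (u n - f) s ≤ ε) {s : ℂ} (hs : 0 < s.re) :
      ‖extendZero (u n) s - extendZero f s‖ ≤ ε * (1 + ‖s‖) ^ ℓ := by
    rw [extendZero_of_pos _ hs, extendZero_of_pos _ hs]
    exact weightedAbs_le_iff.1 (hn ⟨s, hs⟩)
  have hopen : IsOpen {s : ℂ | 0 < s.re} := isOpen_lt continuous_const Complex.continuous_re
  have hol : IsHolomorphic f := by
    have hlim : TendstoLocallyUniformlyOn (fun n => extendZero (u n)) (extendZero f) atTop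
        {s : ℂ | 0 < s.re} := by
      rw [tendstoLocallyUniformlyOn_iff_forall_isCompact hopen]
      intro K hK hKc
      rw [Metric.tendstoUniformlyOn_iff]
      intro ε hε
      obtain ⟨R, hR⟩ := hKc.isBounded.exists_norm_le
      have hR' : 0 < (1 + max R 0) ^ ℓ := by positivity
      obtain ⟨N, hN⟩ := h (ε / 2 / (1 + max R 0) ^ ℓ) (by positivity)
      filter_upwards [eventually_ge_atTop N] with n hn s hs
      rw [dist_comm, dist_eq_norm]
      refine (hdist (hN n hn) (hK hs)).trans_lt ?_
      have h1 : (1 + ‖s‖) ^ ℓ ≤ (1 + max R 0) ^ ℓ := by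
        gcongr
        exact (hR s hs).trans (le_max_left _ _)
      calc _ ≤ ε / 2 / (1 + max R 0) ^ ℓ * (1 + max R 0) ^ ℓ := by gcongr
        _ = ε / 2 := div_mul_cancel₀ _ hR'.ne'
        _ < ε := half_lt_self hε
    exact hlim.differentiableOn (Eventually.of_forall fun n => (hu n).1) hopen
  obtain ⟨N₁, hN₁⟩ := h 1 one_pos
  have hbound (s : RightHalfPlane) : weightedAbs ℓ f s ≤ supNorm ℓ (u N₁) + 1 := by
    have h1 := weightedAbs_add_le ℓ (u N₁) ((-1 : ℂ) • (u N₁ - f)) s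
    rw [weightedAbs_smul, norm_neg, norm_one, one_mul, neg_one_smul, neg_sub,
      add_sub_cancel] at h1
    exact h1.trans (add_le_add (weightedAbs_le_supNorm (hu N₁) s) (hN₁ N₁ le_rfl s))
  have hgf := hasGrowth_extendZero hol hbound
  have hgu (n : ℕ) := hasGrowth_extendZero (hu n).1 (weightedAbs_le_supNorm (hu n))
  -- One order for all `u n`, although the orders and abscissas of their germs may be unbounded.
  obtain ⟨k, hk⟩ := exists_nat_ge (ℓ + 1)
  have hk0 : k ≠ 0 := by
    rintro rfl
    rw [Nat.cast_zero] at hk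
    linarith
  choose a ha using fun n => (hu n).2.1
  have hper (n : ℕ) (x : ℝ) : rieszSum lam k (a n) x = perron (extendZero (u n)) k 1 x := by
    obtain ⟨m, hm, σ, hσ⟩ := ha n
    refine rieszSum_eq_perron hlam (hgu n) hk hk0 hm (σ := σ) (fun s hs hs' => ?_) x
    rw [extendZero_of_pos _ hs]
    exact hσ ⟨s, hs⟩ hs'
  have hconv (x : ℝ) : Tendsto (fun n => rieszSum lam k (a n) x) atTop
      (𝓝 (perron (extendZero f) k 1 x)) := by
    rw [Metric.tendsto_atTop]
    intro ε hε
    have hC : 0 < k.factorial * 2 ^ (k + 1) * Real.exp x := by positivity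
    obtain ⟨N, hN⟩ := h (ε / 2 / (k.factorial * 2 ^ (k + 1) * Real.exp x)) (by positivity)
    refine ⟨N, fun n hn => ?_⟩
    rw [hper, dist_eq_norm, ← (hgu n).perron_sub hgf hk hk0 one_pos]
    refine (((hgu n).sub hgf fun s hs => hdist (hN n hn) hs).norm_perron_one_le hk hk0 x).trans_lt
      ?_
    calc _ = ε / 2 := by field_simp
      _ < ε := half_lt_self hε
  choose l hl using exists_tendsto_coeff hlam hk0 fun x => ⟨_, hconv x⟩
  have hlper (x : ℝ) : rieszSum lam k l x = perron (extendZero f) k 1 x :=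
    tendsto_nhds_unique (tendsto_rieszSum hlam hk0 hl x) (hconv x)
  refine ⟨hol, ⟨l, k, k.cast_nonneg, 1, fun s hs => ?_⟩, supNorm ℓ (u N₁) + 1, ?_⟩
  · rw [← extendZero_coe f s]
    exact tendsto_rieszMean_of_rieszSum_eq_perron hlam hgf hk hk0 hlper hs
  · rintro _ ⟨s, rfl⟩
    exact hbound s

/-- Sequences in `HInfty lam ℓ` that are Cauchy for the weighted supremum norm converge. -/
theorem HInfty.exists_limit {lam : ℕ → ℝ} (hlam : IsFrequency lam) {ℓ : ℝ} (hℓ : 0 ≤ ℓ)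
    {u : ℕ → RightHalfPlane → ℂ} (hu : ∀ n, u n ∈ HInfty lam ℓ)
    (hc : ∀ ε > 0, ∃ N, ∀ m ≥ N, ∀ n ≥ N, supNorm ℓ (u m - u n) < ε) :
    ∃ f ∈ HInfty lam ℓ, ∀ ε > 0, ∃ N, ∀ n ≥ N, supNorm ℓ (u n - f) ≤ ε := by
  have hd {m n : ℕ} {ε : ℝ} (h : supNorm ℓ (u m - u n) < ε) (s : RightHalfPlane) :
      ‖u m s - u n s‖ ≤ ε * (1 + ‖(s : ℂ)‖) ^ ℓ :=
    weightedAbs_le_iff.1 ((HInfty.weightedAbs_le_supNorm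
      ((hInftySubmodule hlam ℓ).sub_mem (hu m) (hu n)) s).trans h.le)
  have hlim (s : RightHalfPlane) : ∃ l, Tendsto (fun n => u n s) atTop (𝓝 l) := by
    refine cauchySeq_tendsto_of_complete (Metric.cauchySeq_iff.2 fun ε hε => ?_)
    have hw : 0 < (1 + ‖(s : ℂ)‖) ^ ℓ := by positivity
    obtain ⟨N, hN⟩ := hc (ε / 2 / (1 + ‖(s : ℂ)‖) ^ ℓ) (by positivity)
    refine ⟨N, fun m hm n hn => ?_⟩
    rw [dist_eq_norm]
    refine (hd (hN m hm n hn) s).trans_lt ?_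
    rw [div_mul_cancel₀ _ hw.ne']
    exact half_lt_self hε
  choose f hf using hlim
  -- Letting `m → ∞` in the Cauchy estimate at each fixed `s`, with `N` independent of `s`.
  have key : ∀ ε > 0, ∃ N, ∀ n ≥ N, ∀ s, weightedAbs ℓ (u n - f) s ≤ ε := by
    intro ε hε
    obtain ⟨N, hN⟩ := hc ε hε
    refine ⟨N, fun n hn s => weightedAbs_le_iff.2 ?_⟩
    refine le_of_tendsto ((hf s).const_sub (u n s)).norm ?_
    filter_upwards [eventually_ge_atTop N] with m hm
    exact hd (hN n hn m hm) s
  refine ⟨f, HInfty.mem_of_tendsto hlam hℓ hu key, fun ε hε => ?_⟩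
  obtain ⟨N, hN⟩ := key ε hε
  exact ⟨N, fun n hn => ciSup_le (hN n hn)⟩

theorem supNorm_smul (ℓ : ℝ) (c : ℂ) (f : RightHalfPlane → ℂ) :
    supNorm ℓ (c • f) = ‖c‖ * supNorm ℓ f := by
  simp only [supNorm, weightedAbs_smul]
  exact (Real.mul_iSup_of_nonneg (norm_nonneg c) _).symm

theorem HInfty.supNorm_eq_zero_iff {lam : ℕ → ℝ} {ℓ : ℝ} {f : RightHalfPlane → ℂ}
    (hf : f ∈ HInfty lam ℓ) : supNorm ℓ f = 0 ↔ f = 0 := by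
  constructor
  · intro h
    funext s
    have h1 := weightedAbs_le_iff.1 ((weightedAbs_le_supNorm hf s).trans h.le)
    rw [zero_mul] at h1
    exact norm_le_zero_iff.1 h1
  · rintro rfl
    simp [supNorm, weightedAbs]

theorem HInfty.supNorm_add_le {lam : ℕ → ℝ} {ℓ : ℝ} {f g : RightHalfPlane → ℂ}
    (hf : f ∈ HInfty lam ℓ) (hg : g ∈ HInfty lam ℓ) :
    supNorm ℓ (f + g) ≤ supNorm ℓ f + supNorm ℓ g :=
  ciSup_le fun s => (weightedAbs_add_le ℓ f g s).trans
    (add_le_add (weightedAbs_le_supNorm hf s) (weightedAbs_le_supNorm hg s))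

theorem isBanachSpace_hInftySubmodule {lam : ℕ → ℝ} (hlam : IsFrequency lam) {ℓ : ℝ}
    (hℓ : 0 ≤ ℓ) : IsBanachSpace (hInftySubmodule hlam ℓ)
      (fun f => supNorm ℓ (f : RightHalfPlane → ℂ)) := by
  let : Norm (hInftySubmodule hlam ℓ) := ⟨fun f => supNorm ℓ (f : RightHalfPlane → ℂ)⟩
  have core : NormedSpace.Core ℂ (hInftySubmodule hlam ℓ) :=
    { norm_nonneg := fun f => Real.iSup_nonneg (weightedAbs_nonneg ℓ f)
      norm_smul := fun c f => supNorm_smul ℓ c f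
      norm_triangle := fun f g => HInfty.supNorm_add_le f.2 g.2
      norm_eq_zero_iff := fun f => (HInfty.supNorm_eq_zero_iff f.2).trans
        Submodule.coe_eq_zero }
  refine ⟨core, ?_⟩
  let : NormedAddCommGroup (hInftySubmodule hlam ℓ) := NormedAddCommGroup.ofCore core
  refine Metric.complete_of_cauchySeq_tendsto fun u hu => ?_
  have hdist (f g : hInftySubmodule hlam ℓ) :
      dist f g = supNorm ℓ ((f : RightHalfPlane → ℂ) - g) := dist_eq_norm f g
  rw [Metric.cauchySeq_iff] at hu
  simp only [hdist] at hu
  obtain ⟨f, hf, hlim⟩ := HInfty.exists_limit hlam hℓ (fun n => (u n).2) hu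
  refine ⟨⟨f, hf⟩, Metric.tendsto_atTop.2 fun ε hε => ?_⟩
  obtain ⟨N, hN⟩ := hlim (ε / 2) (half_pos hε)
  refine ⟨N, fun n hn => ?_⟩
  rw [hdist]
  exact (hN n hn).trans_lt (half_lt_self hε)

end

end RieszDirichlet

/-- For every frequency `lam` and every `ℓ ≥ 0`, the functions in `HInfty lam ℓ` form a linear
space, and this space is a Banach space under the norm `supNorm ℓ`. -/
theorem mainTheorem4 (lam : ℕ → ℝ) (hlam : RieszDirichlet.IsFrequency lam)
    (ℓ : ℝ) (hℓ : 0 ≤ ℓ) :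
    ∃ V : Submodule ℂ (RieszDirichlet.RightHalfPlane → ℂ),
      (V : Set (RieszDirichlet.RightHalfPlane → ℂ)) = RieszDirichlet.HInfty lam ℓ ∧
      RieszDirichlet.IsBanachSpace V
        (fun f => RieszDirichlet.supNorm ℓ (f : RieszDirichlet.RightHalfPlane → ℂ)) :=
  ⟨RieszDirichlet.hInftySubmodule hlam ℓ, rfl,
    RieszDirichlet.isBanachSpace_hInftySubmodule hlam hℓ⟩
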